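/- Let $(R,\mathfrak m)$ be a Noetherian Cohen--Macaulay local ring of dimension one with canonical module $\omega_R$, total ring of fractions $Q(R)$ and integral closure $\overline R$ in $Q(R)$. Assume: (a) there is an $R$-submodule $C\subseteq Q(R)$ with $R\subseteq C\subseteq\overline R$ and $C\cong\omega_R$ (such a $C$ is called a fractional canonical module); (b) $\overline R$ is a finitely generated $R$-module; (c) $\overline R$ is local, with maximal ideal $\mathfrak n$; (d) there is a non-zerodivisor $a\in\mathfrak m$ such that $(a)$ is a reduction of $\mathfrak m$; and that the canonical map $R/\mathfrak m\to\overline R/\mathfrak n$ is bijective. For $x\in\overline R$ put $v(x)=\ell_{\overline R}(\overline R/x\overline R)$; let $\mathrm e(R)$ be the multiplicity and $r=\mathrm r(R)$ the Cohen--Macaulay type of $R$. The ring $R$ is called far-flung Gorenstein if the trace ideal of $\omega_R$ satisfies $\mathrm{tr}_R(\omega_R)=R:\overline R$, where $R:\overline R=\{\alpha\in Q(R):\alpha\overline R\subseteq R\}$. Consider the assertions: (i) $R$ is a far-flung Gorenstein ring. (ii) There exist a fractional canonical module $C$ and generators $f_1,\dots,f_r$ of the $R$-module $C$, whose valuations $n_i=v(f_i)$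 are finite and satisfy $n_1<n_2<\cdots<n_r$, such that the sum-set $\{n_i+n_j:1\le i\le j\le r\}$ contains the integers $0,1,\dots,\mathrm e(R)-1$. Then (ii) implies (i). If $R$ is isomorphic to a numerical semigroup ring $K[|H|]=K[|t^h:h\in H|]$, where $K$ is a field and $H$ is a submonoid of $\mathbb N_0$ with finite complement, then (i) implies (ii) as well. Moreover, for all $C$ and $f_1,\dots,f_r$ as in (ii), one has $n_1=0$, and if $\mathrm e(R)>1$, then $r\ge 2$ and $n_2=1$. -/

import Mathlib

open CategoryTheory IsLocalRing

universe u v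

namespace FarFlung

noncomputable section

/-- The integral closure `R̄` of `R` in its total ring of fractions `Q(R)`
(`FractionRing R` is the localization of `R` at all non-zerodivisors). -/
abbrev Rbar (R : Type u) [CommRing R] : Subalgebra R (FractionRing R) :=
  integralClosure R (FractionRing R)

instance (R : Type u) [CommRing R] : FaithfulSMul R (Rbar R) :=
  (faithfulSMul_iff_algebraMap_injective R (Rbar R)).mpr fun _ _ h ↦
    IsFractionRing.injective R (FractionRing R) (congrArg Subtype.val h)

section LocalRings

variable (R : Type u) [CommRing R]

/-- The `R`-module `Ext^i_R(R/𝔪, M)`. -/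
abbrev ExtResidue [IsLocalRing R] (M : Type u) [AddCommGroup M] [Module R M] (i : ℕ) : Type u :=
  Abelian.Ext.{u} (ModuleCat.of R (ResidueField R)) (ModuleCat.of R M) i

/-- `ω` is a canonical module of the one-dimensional Cohen-Macaulay local ring `R`: it is finitely
generated and `dim_{R/𝔪} Ext^i_R(R/𝔪, ω)` is `1` for `i = 1 = dim R` and `0` for `i ≠ 1`.
Equivalently, it is maximal Cohen-Macaulay, of type one and of finite injective dimension.
(The length of an `R`-module killed by `𝔪` is its dimension over `R/𝔪`.) -/
structure IsCanonicalModule [IsLocalRing R] (ω : Type u) [AddCommGroup ω] [Module R ω] :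
    Prop where
  finite : Module.Finite R ω
  length_ext : ∀ i : ℕ, Module.length R (ExtResidue R ω i) = if i = 1 then 1 else 0

/-- The Cohen-Macaulay type `r(R) = dim_{R/𝔪} Ext^1_R(R/𝔪, R)` of a one-dimensional
Cohen-Macaulay local ring. -/
def cmType [IsLocalRing R] : ℕ∞ := Module.length R (ExtResidue R R 1)

/-- The (Hilbert-Samuel) multiplicity `e(R) = lim ℓ(R/𝔪^n) / n` of a one-dimensional
Noetherian local ring. -/
def multiplicity [IsLocalRing R] : ℝ :=
  Filter.limUnder Filter.atTop fun n : ℕ ↦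
    ((Module.length R (R ⧸ maximalIdeal R ^ n)).toNat : ℝ) / (n : ℝ)

/-- The trace ideal `tr_R(M)`: the image of the evaluation map `Hom_R(M, R) ⊗ M → R`. -/
def traceIdeal (M : Type u) [AddCommGroup M] [Module R M] : Ideal R :=
  ⨆ φ : M →ₗ[R] R, LinearMap.range φ

/-- `R` is far-flung Gorenstein: `tr_R(ω) = R : R̄` as submodules of `Q(R)`, where `ω` is the
canonical module of `R`. -/
def IsFarFlungGorenstein (ω : Type u) [AddCommGroup ω] [Module R ω] : Prop :=
  Submodule.map (Algebra.linearMap R (FractionRing R)) (traceIdeal R ω) =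
    (1 : Submodule R (FractionRing R)) / Subalgebra.toSubmodule (Rbar R)

/-- `C` is a fractional canonical module: `R ⊆ C ⊆ R̄` and `C ≅ ω`. -/
structure IsFractionalCanonicalModule (ω : Type u) [AddCommGroup ω] [Module R ω]
    (C : Submodule R (FractionRing R)) : Prop where
  one_le : 1 ≤ C
  le_Rbar : C ≤ Subalgebra.toSubmodule (Rbar R)
  iso : Nonempty (C ≃ₗ[R] ω)

/-- There is a non-zerodivisor `a ∈ 𝔪` such that `(a)` is a reduction of `𝔪`. -/
def HasPrincipalReduction [IsLocalRing R] : Prop :=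
  ∃ a ∈ maximalIdeal R, a ∈ nonZeroDivisors R ∧
    ∃ n : ℕ, maximalIdeal R ^ (n + 1) = Ideal.span {a} * maximalIdeal R ^ n

/-- The valuation `v(x) = ℓ_S(S / x S)`, to be used for `S = R̄`. -/
def val {S : Type u} [CommRing S] (x : S) : ℕ∞ := Module.length S (S ⧸ Ideal.span {x})

/-- The data of condition (ii): `C` is a fractional canonical module generated by `f_1, …, f_r`,
`r = r(R)`, whose valuations `n_i = v(f_i)` satisfy `n_1 < ⋯ < n_r`, and every integer `k` with
`0 ≤ k ≤ e(R) - 1` has the form `n_i + n_j` with `i ≤ j`. Indices are shifted by one: they run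
through `Fin r = {0, …, r - 1}`. -/
structure IsRohrbachSystem [IsLocalRing R] (ω : Type u) [AddCommGroup ω] [Module R ω]
    (C : Submodule R (FractionRing R)) (r : ℕ) (f : Fin r → Rbar R) (n : Fin r → ℕ) : Prop where
  canonical : IsFractionalCanonicalModule R ω C
  span_eq : C = Submodule.span R (Set.range fun i ↦ (f i : FractionRing R))
  card_eq : (r : ℕ∞) = cmType R
  val_eq : ∀ i, val (f i) = n i
  strictMono : StrictMono n
  sums : ∀ k : ℕ, (k : ℝ) < multiplicity R → ∃ i j, i ≤ j ∧ n i + n j = k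

end LocalRings

/-- The numerical semigroup ring `K[|H|] = K[|t^h : h ∈ H|]`: the power series all of whose
exponents lie in `H`. -/
def semigroupRing (K : Type v) [Field K] (H : AddSubmonoid ℕ) : Subring (PowerSeries K) where
  carrier := {p | ∀ m, PowerSeries.coeff m p ≠ 0 → m ∈ H}
  zero_mem' := by intro m hm; simp at hm
  one_mem' := by
    intro m hm
    rw [PowerSeries.coeff_one] at hm
    have : m = 0 := by by_contra h; simp [h] at hm
    exact this ▸ H.zero_mem
  add_mem' := by
    intro p q hp hq m hm
    by_cases h : PowerSeries.coeff m p = 0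
    · exact hq m (by simpa [h] using hm)
    · exact hp m h
  neg_mem' := by intro p hp m hm; exact hp m (by simpa using hm)
  mul_mem' := by
    intro p q hp hq m hm
    rw [PowerSeries.coeff_mul] at hm
    obtain ⟨x, hx, hne⟩ := Finset.exists_ne_zero_of_sum_ne_zero hm
    rw [← Finset.HasAntidiagonal.mem_antidiagonal.mp hx]
    exact H.add_mem (hp _ (left_ne_zero_of_mul hne)) (hq _ (right_ne_zero_of_mul hne))

end

end FarFlung

/-! Because `R̄` is finite and local, `Q(R)` is a field: it is Artinian, its nilpotents vanish by
Nakayama, and its idempotents are integral, hence lie in the local ring `R̄` and are trivial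
(`isField_fractionRing`). So `R` is a one-dimensional domain and `R̄` is a discrete valuation ring
`V` with the same residue field.

The vanishing of `Ext²(R/𝔪, ω)` and the non-vanishing of `Ext¹(R/𝔪, ω)` make a fractional canonical
module `C` dualizing: `C : (C : I) = I` for nonzero fractional ideals `I`
(`IsCanonicalModule.isDualizing`). The trace of `ω` is `(R : C) C`, and formal work with colons,
using `C : C = R`, shows that it equals `R : V` exactly when `C² = V` (`isFarFlungGorenstein_iff`).

The multiplicity is `e = v(a)` (`multiplicity_eq_ord`). Under (ii) the products `f_i f_j` realize in
`C²` every valuation below `e`. Since the residue fields agree, successive approximation gives `V =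
C² + aV`, and Nakayama gives `V = C²` (`eq_top_of_forall_ord`).

For a semigroup ring with Frobenius number `F`, take for `C` the series whose exponents `n` satisfy
`F - n ∉ H`. It is canonical because no module lies strictly between `C` and `C : 𝔪`
(`IsDualizing.nonempty_linearEquiv`). It is generated by monomials, whose number is the type
(`SemigroupCoordinates.cmType_eq`). If `C² = V`, each `t^k` gives `k = g + g' + h` with exponents
`g, g'` of generators and `h ∈ H`; for `k < e` this forces `h = 0`, as nonzero elements of `H` are
at least `e`.

The last assertion holds because `0 = 0 + 0` and `1 = 0 + 1` are the only ways to write `0` and `1`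
as sums. -/

namespace FarFlung

noncomputable section

/-! ### Ext of the residue field through maps on the maximal ideal -/

section Ext

variable (R : Type u) [CommRing R] [IsLocalRing R]

/-- The short exact sequence `0 → 𝔪 → R → R/𝔪 → 0`. -/
abbrev residueSequence : ShortComplex (ModuleCat.{u} R) :=
  ShortComplex.mk (X₁ := ModuleCat.of R (maximalIdeal R)) (X₂ := ModuleCat.of R R)
    (X₃ := ModuleCat.of R (ResidueField R))
    (ModuleCat.ofHom (maximalIdeal R).subtype)
    (ModuleCat.ofHom (Algebra.linearMap R (ResidueField R))) (by
      ext x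
      exact (residue_eq_zero_iff _).mpr x.2)

lemma residueSequence_shortExact : (residueSequence R).ShortExact := by
  refine ModuleCat.shortComplex_shortExact _ ?_ ?_ ?_
  · intro x
    exact (residue_eq_zero_iff (R := R) x).trans
      ⟨fun h ↦ ⟨⟨x, h⟩, rfl⟩, by rintro ⟨y, rfl⟩; exact y.2⟩
  · exact Subtype.val_injective
  · exact residue_surjective

instance : Projective (residueSequence R).X₂ :=
  inferInstanceAs (Projective (ModuleCat.of R R))

variable {R} (M : Type u) [AddCommGroup M] [Module R M]

/-- The connecting map `Hom(𝔪, M) → Ext¹(R/𝔪, M)`. -/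
def extConnecting : (maximalIdeal R →ₗ[R] M) →ₗ[R] ExtResidue R M 1 :=
  (Abelian.Ext.precompOfLinear (residueSequence_shortExact R).extClass R (ModuleCat.of R M)
    (add_zero 1)) ∘ₗ (Abelian.Ext.linearEquiv₀ (R := R)).symm.toLinearMap ∘ₗ
    (ModuleCat.homLinearEquiv (S := R) (M := ModuleCat.of R (maximalIdeal R))
      (N := ModuleCat.of R M)).symm.toLinearMap

lemma extConnecting_surjective : Function.Surjective (extConnecting (R := R) M) := by
  intro x
  obtain ⟨y, hy⟩ := Abelian.Ext.contravariant_sequence_exact₃ (residueSequence_shortExact R) _ x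
    (Abelian.Ext.eq_zero_of_projective _) (add_zero 1)
  refine ⟨ModuleCat.homLinearEquiv (S := R) (M := ModuleCat.of R (maximalIdeal R))
    (N := ModuleCat.of R M) (Abelian.Ext.linearEquiv₀ (R := R) y), ?_⟩
  simpa [extConnecting] using hy

lemma extConnecting_eq_zero_iff (φ : maximalIdeal R →ₗ[R] M) :
    extConnecting M φ = 0 ↔ ∃ x : M, ∀ r, φ r = (r : R) • x := by
  constructor
  · intro h
    obtain ⟨y, hy⟩ := Abelian.Ext.contravariant_sequence_exact₁ (residueSequence_shortExact R) _
      (Abelian.Ext.mk₀ (ModuleCat.ofHom φ)) (add_zero 1) h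
    obtain ⟨g, rfl⟩ := (Abelian.Ext.mk₀_bijective _ _).2 y
    rw [Abelian.Ext.mk₀_comp_mk₀] at hy
    have hg := (Abelian.Ext.mk₀_bijective _ _).1 hy
    let g' : R →ₗ[R] M := g.hom
    refine ⟨g' 1, fun r ↦ ?_⟩
    have h2 := congrArg (fun f ↦ f.hom r) hg
    rw [← map_smul, smul_eq_mul, mul_one]
    exact h2.symm
  · rintro ⟨x, hx⟩
    have h1 : ModuleCat.ofHom φ = (residueSequence R).f ≫
        ModuleCat.ofHom (LinearMap.toSpanSingleton R M x) := by
      ext r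
      exact hx r
    change (residueSequence_shortExact R).extClass.comp (Abelian.Ext.mk₀ (ModuleCat.ofHom φ))
      (add_zero 1) = 0
    rw [h1, ← Abelian.Ext.mk₀_comp_mk₀]
    exact (residueSequence_shortExact R).extClass_comp_assoc _

variable {M} in
/-- If `Ext²(R/𝔪, M) = 0` and `0 → M → N → P → 0` is exact, then every linear map `𝔪 → P` lifts
to `N`. -/
lemma exists_lift_of_ext_two {N P : Type u} [AddCommGroup N] [Module R N] [AddCommGroup P]
    [Module R P] (h2 : Subsingleton (ExtResidue R M 2)) (f : M →ₗ[R] N) (g : N →ₗ[R] P)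
    (hf : Function.Injective f) (hg : Function.Surjective g) (hfg : Function.Exact f g)
    (φ : maximalIdeal R →ₗ[R] P) : ∃ ψ : maximalIdeal R →ₗ[R] N, g ∘ₗ ψ = φ := by
  let S : ShortComplex (ModuleCat.{u} R) := ShortComplex.mk (ModuleCat.ofHom f)
    (ModuleCat.ofHom g) (by ext x; exact hfg.apply_apply_eq_zero x)
  have hS : S.ShortExact := ModuleCat.shortComplex_shortExact _ hfg hf hg
  -- Dimension shift: `R` is projective, so `Ext¹(𝔪, M)` embeds in `Ext²(R/𝔪, M)`.
  have h1 : ∀ x : Abelian.Ext.{u} (ModuleCat.of R (maximalIdeal R)) (ModuleCat.of R M) 1, x = 0 := by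
    intro x
    have hx : (residueSequence_shortExact R).extClass.comp x (rfl : 1 + 1 = 2) = 0 :=
      h2.elim _ _
    obtain ⟨y, rfl⟩ := Abelian.Ext.contravariant_sequence_exact₁ (residueSequence_shortExact R)
      _ x rfl hx
    rw [Abelian.Ext.eq_zero_of_projective y]
    exact Abelian.Ext.comp_zero _ _ _ _ _
  obtain ⟨y, hy⟩ := Abelian.Ext.covariant_sequence_exact₃ _ hS
    (Abelian.Ext.mk₀ (ModuleCat.ofHom φ)) (zero_add 1) (h1 _)
  obtain ⟨ψ, rfl⟩ := (Abelian.Ext.mk₀_bijective _ _).2 y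
  rw [Abelian.Ext.mk₀_comp_mk₀] at hy
  have h := (Abelian.Ext.mk₀_bijective _ _).1 hy
  exact ⟨ψ.hom, congrArg ModuleCat.Hom.hom h⟩

end Ext

/-! ### Socle elements in dimension one -/

section Socle

variable {R : Type*} [CommRing R] [IsNoetherianRing R] [IsLocalRing R] [Ring.DimensionLEOne R]

lemma exists_maximalIdeal_pow_le {I : Ideal R} (hI : I ≠ ⊥) :
    ∃ n : ℕ, maximalIdeal R ^ n ≤ I := by
  have h : maximalIdeal R ≤ I.radical := by
    rw [Ideal.radical_eq_sInf]
    refine le_sInf ?_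
    rintro P ⟨hIP, hP⟩
    have := Ring.DimensionLEOne.maximalOfPrime (fun h ↦ hI (le_bot_iff.mp (h ▸ hIP))) hP
    exact (eq_maximalIdeal this).ge
  obtain ⟨n, hn⟩ := Ideal.exists_radical_pow_le_of_fg I (IsNoetherian.noetherian _)
  exact ⟨n, (Ideal.pow_right_mono h n).trans hn⟩

/-- Some power of `𝔪` lies in `(d)` and so carries `y` into `N`. For the least such power, an
element of the preceding power that does not carry `y` into `N` carries it into the socle of `E/N`.
-/
lemma exists_smul_mem_socle {E : Type*} [AddCommGroup E] [Module R E] {N : Submodule R E} {y : E}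
    (hy : y ∉ N) {d : R} (hd : d ≠ 0) (hdy : d • y ∈ N) :
    ∃ r : R, r • y ∉ N ∧ ∀ s ∈ maximalIdeal R, s • r • y ∈ N := by
  classical
  have hex : ∃ n : ℕ, ∀ r ∈ maximalIdeal R ^ n, r • y ∈ N := by
    obtain ⟨n, hn⟩ := exists_maximalIdeal_pow_le (I := Ideal.span {d}) (by simpa using hd)
    refine ⟨n, fun r hr ↦ ?_⟩
    obtain ⟨c, rfl⟩ := Ideal.mem_span_singleton'.mp (hn hr)
    rw [mul_smul]
    exact N.smul_mem _ hdy
  have h0 : Nat.find hex ≠ 0 := by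
    intro h
    have := Nat.find_spec hex
    rw [h] at this
    exact hy (by simpa using this 1 (by simp))
  obtain ⟨k, hk⟩ := Nat.exists_eq_succ_of_ne_zero h0
  have h1 := Nat.find_min hex (m := k) (by omega)
  push Not at h1
  obtain ⟨r, hr, hry⟩ := h1
  refine ⟨r, hry, fun s hs ↦ ?_⟩
  rw [smul_smul]
  apply Nat.find_spec hex
  rw [hk, pow_succ']
  exact Ideal.mul_mem_mul hs hr

end Socle

/-! ### Extending maps from ideals -/

section Extension

variable {R : Type*} [CommRing R]

/-- The hypothesis makes `x ↦ z` well defined on `Rx` and says that it agrees with `g` on `I ∩ Rx`,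
so the two maps glue. -/
lemma exists_extension_sup_span {E N : Type*} [AddCommGroup E] [Module R E] [AddCommGroup N]
    [Module R N] (I : Submodule R E) (g : I →ₗ[R] N) (x : E) (z : N)
    (h : ∀ (r : R) (hr : r • x ∈ I), g ⟨r • x, hr⟩ = r • z) :
    ∃ g' : ↥(I ⊔ Submodule.span R {x}) →ₗ[R] N,
      (∀ i (hi : i ∈ I), g' ⟨i, Submodule.mem_sup_left hi⟩ = g ⟨i, hi⟩) ∧
      g' ⟨x, Submodule.mem_sup_right (Submodule.mem_span_singleton_self x)⟩ = z := by
  have H : ∀ c : R, c • x = 0 → c • z = 0 := by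
    intro c hc
    have h2 : (⟨c • x, hc ▸ I.zero_mem⟩ : I) = 0 := Subtype.ext hc
    rw [← h c (hc ▸ I.zero_mem), h2, map_zero]
  let f₁ : E →ₗ.[R] N := ⟨I, g⟩
  let f₂ : E →ₗ.[R] N := LinearPMap.mkSpanSingleton' x z H
  have hagree : ∀ (a : f₁.domain) (b : f₂.domain), (a : E) = b → f₁ a = f₂ b := by
    rintro ⟨a, ha⟩ ⟨b, hb⟩ (rfl : a = b)
    obtain ⟨c, rfl⟩ := Submodule.mem_span_singleton.mp hb
    exact (h c ha).trans (LinearPMap.mkSpanSingleton'_apply x z H c hb).symm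
  have hx : x ∈ f₂.domain := Submodule.mem_span_singleton_self x
  refine ⟨(f₁.sup f₂ hagree).toFun, fun i hi ↦ ?_, ?_⟩
  · exact ((LinearPMap.left_le_sup f₁ f₂ hagree).2 (x := ⟨i, hi⟩) rfl).symm
  · exact ((LinearPMap.right_le_sup f₁ f₂ hagree).2 (x := ⟨x, hx⟩) rfl).symm.trans
      (LinearPMap.mkSpanSingleton'_apply_self x z H hx)

variable [IsNoetherianRing R] [IsLocalRing R] [Ring.DimensionLEOne R]

/-- Over a one-dimensional local ring, it is enough to test injectivity on the maximal ideal, as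
far as nonzero ideals are concerned. -/
lemma exists_eq_smul_of_maximalIdeal {N : Type*} [AddCommGroup N] [Module R N]
    (hm : ∀ φ : maximalIdeal R →ₗ[R] N, ∃ z, ∀ r, φ r = (r : R) • z)
    (I : Ideal R) (hI : I ≠ ⊥) (g : I →ₗ[R] N) : ∃ z, ∀ r, g r = (r : R) • z := by
  induction I using IsNoetherian.induction with
  | hgt I ih =>
  by_cases htop : I = ⊤
  · subst htop
    refine ⟨g ⟨1, trivial⟩, fun r ↦ ?_⟩
    rw [← map_smul]
    congr 1
    ext
    simp
  obtain ⟨d, hd, hd0⟩ := Submodule.exists_mem_ne_zero_of_ne_bot hI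
  -- For `x` in the socle of `R/I`, multiplication by `x` maps `𝔪` into `I`; the `z` representing
  -- `g(· x)` on `𝔪` is the value at `x` of an extension of `g` to a larger ideal, where Noetherian
  -- induction applies.
  obtain ⟨x, hx, hmx⟩ := exists_smul_mem_socle (N := I) (y := (1 : R))
    (fun h ↦ htop ((Ideal.eq_top_iff_one _).mpr h)) hd0 (by simpa using hd)
  simp only [smul_eq_mul, mul_one] at hx hmx
  let φ : maximalIdeal R →ₗ[R] I := LinearMap.codRestrict I
    (LinearMap.mulRight R x ∘ₗ (maximalIdeal R).subtype) (fun s ↦ hmx s s.2)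
  obtain ⟨z, hz⟩ := hm (g ∘ₗ φ)
  obtain ⟨g', hg', -⟩ := exists_extension_sup_span I g x z (by
    intro r hr
    have hrm : r ∈ maximalIdeal R := by
      by_contra hu
      have hu' : IsUnit r := by simpa using hu
      obtain ⟨s, hs⟩ := hu'.exists_left_inv
      refine hx ?_
      have := Ideal.mul_mem_left I s hr
      rwa [smul_eq_mul, ← mul_assoc, hs, one_mul] at this
    exact hz ⟨r, hrm⟩)
  have hlt : I < I ⊔ Submodule.span R {x} := by
    refine lt_of_le_of_ne le_sup_left fun h ↦ hx ?_
    rw [h]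
    exact Submodule.mem_sup_right (Submodule.mem_span_singleton_self x)
  obtain ⟨w, hw⟩ := ih _ hlt (ne_bot_of_gt hlt) g'
  refine ⟨w, fun r ↦ ?_⟩
  rw [← hw ⟨r, Submodule.mem_sup_left r.2⟩, hg' r r.2]

end Extension

/-! ### Duality for fractional ideals -/

section Duality

variable {R : Type*} [CommRing R] [IsNoetherianRing R] [IsLocalRing R]
  [Ring.DimensionLEOne R] {Q : Type*} [Field Q] [Algebra R Q] [IsFractionRing R Q]

/-- Multiplication by a common denominator `d` turns `J` into a nonzero ideal, where maps to `Q ⧸ C`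
are already known to be given by an element. -/
lemma exists_mul_of_hom_quotient {C : Submodule R Q}
    (hm : ∀ φ : maximalIdeal R →ₗ[R] Q ⧸ C, ∃ z, ∀ r, φ r = (r : R) • z)
    {J : Submodule R Q} (hJ : IsFractional (nonZeroDivisors R) J) (hJ0 : J ≠ ⊥)
    (φ : J →ₗ[R] Q ⧸ C) : ∃ y : Q, ∀ x, φ x = C.mkQ (y * x) := by
  obtain ⟨d, hd, hdJ⟩ := hJ
  have hd0 : algebraMap R Q d ≠ 0 := by
    simpa using nonZeroDivisors.ne_zero hd
  let f : R →ₗ[R] Q := LinearMap.toSpanSingleton R Q (algebraMap R Q d)⁻¹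
  have key : ∀ x ∈ J, ∃ s, f s = x ∧ algebraMap R Q s = algebraMap R Q d * x := by
    intro x hx
    obtain ⟨s, hs⟩ := hdJ x hx
    rw [Algebra.smul_def] at hs
    refine ⟨s, ?_, hs⟩
    simp only [f, LinearMap.toSpanSingleton_apply, Algebra.smul_def, hs]
    field_simp
  obtain ⟨x₀, hx₀, hx₀0⟩ := Submodule.exists_mem_ne_zero_of_ne_bot hJ0
  obtain ⟨s₀, hs₀, -⟩ := key x₀ hx₀
  have hI : J.comap f ≠ ⊥ := by
    intro h
    have : s₀ ∈ J.comap f := by rwa [Submodule.mem_comap, hs₀]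
    rw [h, Submodule.mem_bot] at this
    rw [this, map_zero] at hs₀
    exact hx₀0 hs₀.symm
  obtain ⟨z, hz⟩ := exists_eq_smul_of_maximalIdeal hm (J.comap f) hI
    (φ ∘ₗ (f.restrict (p := J.comap f) (q := J) fun _ h ↦ h))
  obtain ⟨y₀, rfl⟩ := C.mkQ_surjective z
  refine ⟨algebraMap R Q d * y₀, fun x ↦ ?_⟩
  obtain ⟨s, hs, hs'⟩ := key x x.2
  have := hz ⟨s, by rw [Submodule.mem_comap, hs]; exact x.2⟩
  have h2 : f.restrict (p := J.comap f) (q := J) (fun _ h ↦ h)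
      ⟨s, by rw [Submodule.mem_comap, hs]; exact x.2⟩ = x := Subtype.ext hs
  rw [LinearMap.comp_apply, h2] at this
  rw [this, ← map_smul, Algebra.smul_def, hs']
  congr 1
  ring

/-- `C` separates fractional ideals by duality: `C : I ⊆ C : J` implies `J ⊆ I`. -/
def IsDualizing (C : Submodule R Q) : Prop :=
  ∀ I J : Submodule R Q, IsFractional (nonZeroDivisors R) I → I ≠ ⊥ → C / I ≤ C / J → J ≤ I

/-- If `J ⊄ I`, some `x ∈ J` outside `I` has `𝔪x ⊆ I`. The map on `I + Rx` that kills `I` and sends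
`x` to the socle element of `Q/C` is multiplication by some `w`. Then `w ∈ C : I` but `wx ∉ C`, so
`C : I ⊄ C : J`. -/
lemma isDualizing_of_exists [IsDomain R] {C : Submodule R Q}
    (hm : ∀ φ : maximalIdeal R →ₗ[R] Q ⧸ C, ∃ z, ∀ r, φ r = (r : R) • z)
    (hC : ∃ z ∉ C, ∀ r ∈ maximalIdeal R, r • z ∈ C) : IsDualizing C := by
  intro I J hI hI0 hIJ
  by_contra hle
  obtain ⟨y, hyJ, hyI⟩ := SetLike.not_le_iff_exists.mp hle
  obtain ⟨q, hqI, hq0⟩ := Submodule.exists_mem_ne_zero_of_ne_bot hI0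
  obtain ⟨p, s, hs, hps⟩ := IsFractionRing.div_surjective (A := R) (y / q)
  have hs0 : algebraMap R Q s ≠ 0 := by simpa using nonZeroDivisors.ne_zero hs
  have hsy : s • y = p • q := by
    rw [Algebra.smul_def, Algebra.smul_def]
    field_simp at hps
    rw [hps]
  obtain ⟨r, hr, hmr⟩ := exists_smul_mem_socle hyI (nonZeroDivisors.ne_zero hs)
    (hsy ▸ I.smul_mem p hqI)
  obtain ⟨z, hzC, hmz⟩ := hC
  set x := r • y with hx
  have hunit : ∀ c : R, c • x ∈ I → c ∈ maximalIdeal R := by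
    intro c hc
    by_contra hu
    have hu' : IsUnit c := by simpa using hu
    obtain ⟨b, hb⟩ := hu'.exists_left_inv
    refine hr ?_
    have := I.smul_mem b hc
    rwa [smul_smul, hb, one_smul] at this
  obtain ⟨g, hg, hgx⟩ := exists_extension_sup_span I (0 : I →ₗ[R] Q ⧸ C) x (C.mkQ z) (by
    intro c hc
    rw [LinearMap.zero_apply, ← map_smul, eq_comm, Submodule.mkQ_apply,
      Submodule.Quotient.mk_eq_zero]
    exact hmz c (hunit c hc))
  have hfrac : IsFractional (nonZeroDivisors R) (I ⊔ Submodule.span R {x}) :=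
    hI.sup (FractionalIdeal.isFractional_of_fg (Submodule.fg_span_singleton x))
  obtain ⟨w, hw⟩ := exists_mul_of_hom_quotient hm hfrac
    (fun h ↦ hI0 (le_bot_iff.mp (h ▸ le_sup_left))) g
  have hwI : w ∈ C / I := by
    rw [Submodule.mem_div_iff_forall_mul_mem]
    intro i hi
    have := hw ⟨i, Submodule.mem_sup_left hi⟩
    rw [hg i hi, LinearMap.zero_apply] at this
    rwa [eq_comm, Submodule.mkQ_apply, Submodule.Quotient.mk_eq_zero] at this
  have hwx : w * x ∈ C := Submodule.mem_div_iff_forall_mul_mem.mp (hIJ hwI) x (J.smul_mem r hyJ)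
  have := hw ⟨x, Submodule.mem_sup_right (Submodule.mem_span_singleton_self x)⟩
  rw [hgx] at this
  apply hzC
  rw [← Submodule.Quotient.mk_eq_zero, ← Submodule.mkQ_apply, this, Submodule.mkQ_apply,
    Submodule.Quotient.mk_eq_zero]
  exact hwx

end Duality

/-! ### Colon calculus with a dualizing module -/

section DualizingFormal

variable {R : Type*} [CommRing R] {Q : Type*} [Field Q] [Algebra R Q]

lemma isFractional_mono {I J : Submodule R Q} (h : I ≤ J)
    (hJ : IsFractional (nonZeroDivisors R) J) : IsFractional (nonZeroDivisors R) I :=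
  let ⟨d, hd, hd'⟩ := hJ
  ⟨d, hd, fun b hb ↦ hd' b (h hb)⟩

lemma le_div_div (C I : Submodule R Q) : I ≤ C / (C / I) := by
  rw [Submodule.le_div_iff_mul_le, mul_comm, ← Submodule.le_div_iff_mul_le]

lemma div_one_eq (C : Submodule R Q) : C / 1 = C := by
  refine le_antisymm (fun x hx ↦ ?_) ?_
  · simpa using Submodule.mem_div_iff_forall_mul_mem.mp hx 1 (Submodule.one_le.mp le_rfl)
  · rw [Submodule.le_div_iff_mul_le, mul_one]

lemma div_anti (C : Submodule R Q) {I J : Submodule R Q} (h : I ≤ J) : C / J ≤ C / I :=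
  fun _ hx ↦ Submodule.mem_div_iff_forall_mul_mem.mpr fun y hy ↦
    Submodule.mem_div_iff_forall_mul_mem.mp hx y (h hy)

lemma IsDualizing.div_div {C : Submodule R Q} (hC : IsDualizing C) {I : Submodule R Q}
    (hI : IsFractional (nonZeroDivisors R) I) (hI0 : I ≠ ⊥) : C / (C / I) = I :=
  le_antisymm (hC I _ hI hI0 (le_div_div C _)) (le_div_div C I)

lemma one_ne_bot : (1 : Submodule R Q) ≠ ⊥ := by
  intro h
  have : (1 : Q) ∈ (1 : Submodule R Q) := Submodule.one_le.mp le_rfl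
  rw [h, Submodule.mem_bot] at this
  exact one_ne_zero this

lemma IsDualizing.div_self {C : Submodule R Q} (hC : IsDualizing C) : C / C = 1 := by
  have := hC.div_div (FractionalIdeal.isFractional_of_le_one _ le_rfl) one_ne_bot
  rwa [div_one_eq] at this

/-- For a dualizing module `C` with `R ⊆ C ⊆ S`, one has `(R : C) C = R : S` if and only if
`C² = S`. -/
lemma IsDualizing.one_div_mul_eq_iff {C : Submodule R Q} (hC : IsDualizing C) (h1 : 1 ≤ C)
    {S : Subalgebra R Q} (hCS : C ≤ Subalgebra.toSubmodule S)
    (hS : IsFractional (nonZeroDivisors R) (Subalgebra.toSubmodule S)) :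
    (1 / C) * C = 1 / Subalgebra.toSubmodule S ↔ C * C = Subalgebra.toSubmodule S := by
  set V := Subalgebra.toSubmodule S with hV
  have hVV : V * V = V := Subalgebra.isIdempotentElem_toSubmodule S
  have h1V : 1 ≤ V := h1.trans hCS
  have hCV : C * V = V := le_antisymm ((mul_le_mul' hCS le_rfl).trans hVV.le)
    (by simpa using mul_le_mul' h1 (le_refl V))
  constructor
  · intro h
    have hsq : C * C ≤ V := (mul_le_mul' hCS hCS).trans hVV.le
    have hle : 1 / C ≤ 1 / V := by
      rw [Submodule.le_div_iff_mul_le]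
      calc 1 / C * V = 1 / C * C * V := by rw [mul_assoc, hCV]
        _ ≤ 1 := by rw [h, ← Submodule.le_div_iff_mul_le]
    -- `C : C² ⊆ (C : C) : C = R : C ⊆ R : V ⊆ C : V`, and duality reverses this to `V ⊆ C²`.
    refine le_antisymm hsq (hC _ _ (isFractional_mono hsq hS) ?_ ?_)
    · intro h0
      refine one_ne_bot (R := R) (Q := Q) (le_bot_iff.mp ?_)
      rw [← h0]
      simpa using mul_le_mul' h1 h1
    · have h2 : C / (C * C) ≤ 1 / C := by
        rw [Submodule.le_div_iff_mul_le, ← hC.div_self, Submodule.le_div_iff_mul_le, mul_assoc,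
          ← Submodule.le_div_iff_mul_le]
      refine (h2.trans hle).trans ?_
      rw [Submodule.le_div_iff_mul_le]
      refine le_trans ?_ h1
      rw [← Submodule.le_div_iff_mul_le]
  · intro h
    refine le_antisymm ?_ ?_
    · have h2 : 1 / C * V ≤ C / C := by
        rw [Submodule.le_div_iff_mul_le, mul_assoc, mul_comm V, hCV, ← h, ← mul_assoc]
        calc 1 / C * C * C ≤ 1 * C := mul_le_mul'
              (by rw [← Submodule.le_div_iff_mul_le]) le_rfl
          _ = C := one_mul C
      rw [Submodule.le_div_iff_mul_le, mul_assoc, hCV]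
      exact h2.trans hC.div_self.le
    · calc 1 / V = 1 / V * 1 := (mul_one _).symm
        _ ≤ 1 / C * C := mul_le_mul' (div_anti 1 hCS) h1

end DualizingFormal

/-! ### The trace ideal as a product of fractional ideals -/

section Trace

variable {R : Type u} [CommRing R] {Q : Type*} [Field Q] [Algebra R Q] [IsFractionRing R Q]

lemma apply_eq_mul_apply_one {C : Submodule R Q} (h1 : (1 : Q) ∈ C) (φ : C →ₗ[R] Q) (x : C) :
    φ x = x * φ ⟨1, h1⟩ := by
  obtain ⟨p, s, hs, hps⟩ := IsFractionRing.div_surjective (A := R) (x : Q)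
  have hs0 : algebraMap R Q s ≠ 0 := ((IsLocalization.map_units Q ⟨s, hs⟩).ne_zero :)
  have h : s • x = p • (⟨1, h1⟩ : C) := by
    ext
    simp only [Submodule.coe_smul, Algebra.smul_def, ← hps]
    field_simp
  have h2 := congrArg φ h
  rw [map_smul, map_smul, Algebra.smul_def, Algebra.smul_def] at h2
  rw [← hps, div_mul_eq_mul_div, ← h2]
  field_simp

/-- Linear maps `C → R` are multiplications by the elements of `R : C`, so their images add up to
`(R : C) C`. -/
lemma map_traceIdeal {M : Type u} [AddCommGroup M] [Module R M] {C : Submodule R Q} (e : C ≃ₗ[R] M)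
    (h1 : 1 ≤ C) : Submodule.map (Algebra.linearMap R Q) (traceIdeal R M) = (1 / C) * C := by
  have h1' : (1 : Q) ∈ C := Submodule.one_le.mp h1
  refine le_antisymm ?_ ?_
  · rw [traceIdeal, Submodule.map_iSup]
    refine iSup_le fun φ ↦ ?_
    rintro _ ⟨_, ⟨m, rfl⟩, rfl⟩
    have h : ∀ x : C, algebraMap R Q (φ (e x)) = x * algebraMap R Q (φ (e ⟨1, h1'⟩)) :=
      apply_eq_mul_apply_one h1' (Algebra.linearMap R Q ∘ₗ φ ∘ₗ e.toLinearMap)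
    rw [Algebra.linearMap_apply, ← e.apply_symm_apply m, h,
      mul_comm (e.symm m : Q)]
    refine Submodule.mul_mem_mul ?_ (Subtype.coe_prop _)
    rw [Submodule.mem_div_iff_forall_mul_mem]
    intro y hy
    rw [mul_comm, ← h ⟨y, hy⟩]
    exact Submodule.algebraMap_mem _
  · rw [Submodule.mul_le]
    intro y hy x hx
    have hy' : ∀ c : C, ∃ r : R, algebraMap R Q r = y * c := fun c ↦
      Submodule.mem_one.mp (Submodule.mem_div_iff_forall_mul_mem.mp hy c c.2)
    choose g hg using hy'
    have hinj : Function.Injective (algebraMap R Q) := IsFractionRing.injective R Q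
    let φ : C →ₗ[R] R :=
      { toFun := g
        map_add' := fun a b ↦ hinj (by simp only [hg, map_add, Submodule.coe_add, mul_add])
        map_smul' := fun r a ↦ hinj (by
          simp only [hg, RingHom.id_apply, smul_eq_mul, map_mul, Submodule.coe_smul,
            Algebra.smul_def]
          ring) }
    refine ⟨g ⟨x, hx⟩, ?_, hg ⟨x, hx⟩⟩
    refine (le_iSup (fun φ : M →ₗ[R] R ↦ LinearMap.range φ) (φ ∘ₗ e.symm.toLinearMap)) ?_
    exact ⟨e ⟨x, hx⟩, by simp [φ]⟩

end Trace

/-! ### First Ext of a fractional ideal -/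

section ExtFractional

variable {R : Type u} [CommRing R] [IsLocalRing R] {Q : Type*} [Field Q] [Algebra R Q]
  [IsFractionRing R Q]

lemma exists_eq_smul_of_hom (hR : maximalIdeal R ≠ ⊥) (ψ : maximalIdeal R →ₗ[R] Q) :
    ∃ z : Q, ∀ r, ψ r = (r : R) • z := by
  obtain ⟨a, ha, ha0⟩ := Submodule.exists_mem_ne_zero_of_ne_bot hR
  have ha' : algebraMap R Q a ≠ 0 := by simpa using ha0
  refine ⟨ψ ⟨a, ha⟩ / algebraMap R Q a, fun r ↦ ?_⟩
  have h : a • r = (r : R) • (⟨a, ha⟩ : maximalIdeal R) := by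
    ext
    simp [mul_comm]
  have h2 := congrArg ψ h
  rw [map_smul, map_smul, Algebra.smul_def, Algebra.smul_def] at h2
  rw [Algebra.smul_def, mul_div_assoc', ← h2]
  field_simp


/-- The colon module `C :_Q 𝔪`. -/
def maxColon (C : Submodule R Q) : Submodule R Q where
  carrier := {z | ∀ r ∈ maximalIdeal R, r • z ∈ C}
  add_mem' ha hb r hr := by
    rw [smul_add]
    exact C.add_mem (ha r hr) (hb r hr)
  zero_mem' r _ := by simp
  smul_mem' c z hz r hr := by
    rw [smul_comm]
    exact C.smul_mem c (hz r hr)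

/-- For a fractional ideal `C ≅ M`, the module `Ext¹(R/𝔪, M)` is `(C : 𝔪) / C`. -/
lemma exists_ext_one_map (hR : maximalIdeal R ≠ ⊥) {M : Type u} [AddCommGroup M] [Module R M]
    {C : Submodule R Q} (e : C ≃ₗ[R] M) :
    ∃ Θ : maxColon C →ₗ[R] ExtResidue R M 1, Function.Surjective Θ ∧
      ∀ z, Θ z = 0 ↔ (z : Q) ∈ C := by
  let μ : maxColon C →ₗ[R] (maximalIdeal R →ₗ[R] M) :=
    { toFun := fun z ↦ e.toLinearMap ∘ₗ LinearMap.codRestrict C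
        (LinearMap.toSpanSingleton R Q z ∘ₗ (maximalIdeal R).subtype) (fun r ↦ z.2 r r.2)
      map_add' := fun a b ↦ by
        ext r
        simp only [LinearMap.coe_comp, LinearEquiv.coe_coe, Function.comp_apply,
          LinearMap.add_apply, ← map_add]
        congr 1
        ext
        exact smul_add _ _ _
      map_smul' := fun c a ↦ by
        ext r
        refine e.symm.injective ?_
        simp only [LinearMap.coe_comp, LinearEquiv.coe_coe, Function.comp_apply,
          LinearMap.smul_apply, map_smul, RingHom.id_apply, LinearEquiv.symm_apply_apply]
        ext
        exact smul_comm (r : R) c (a : Q) }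
  have hμ : ∀ z r, (e.symm (μ z r) : Q) = (r : R) • (z : Q) := fun z r ↦ by
    change ((e.symm (e _) : C) : Q) = _
    rw [e.symm_apply_apply]
    rfl
  refine ⟨extConnecting M ∘ₗ μ, ?_, fun z ↦ ?_⟩
  · intro x
    obtain ⟨φ, rfl⟩ := extConnecting_surjective M x
    obtain ⟨z, hz⟩ := exists_eq_smul_of_hom hR (C.subtype ∘ₗ e.symm.toLinearMap ∘ₗ φ)
    have hz' : ∀ r, (e.symm (φ r) : Q) = (r : R) • z := hz
    refine ⟨⟨z, fun r hr ↦ ?_⟩, ?_⟩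
    · rw [← hz' ⟨r, hr⟩]
      exact Subtype.coe_prop _
    · rw [LinearMap.comp_apply]
      congr 1
      ext r
      apply e.symm.injective
      ext
      rw [hμ, hz']
  · rw [LinearMap.comp_apply, extConnecting_eq_zero_iff]
    constructor
    · rintro ⟨x, hx⟩
      obtain ⟨a, ha, ha0⟩ := Submodule.exists_mem_ne_zero_of_ne_bot hR
      have ha' : algebraMap R Q a ≠ 0 := by simpa using ha0
      have h := hμ z ⟨a, ha⟩
      rw [hx, map_smul, Submodule.coe_smul, Algebra.smul_def, Algebra.smul_def] at h
      rw [← mul_left_cancel₀ ha' h]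
      exact Subtype.coe_prop _
    · intro hz
      refine ⟨e ⟨z, hz⟩, fun r ↦ e.symm.injective ?_⟩
      ext
      rw [hμ]
      simp

/-- The length of `Ext¹(R/𝔪, M)` computed from a map with source `C : 𝔪` and kernel `C`. -/
lemma length_ext_one (hR : maximalIdeal R ≠ ⊥) {M : Type u} [AddCommGroup M] [Module R M]
    {C : Submodule R Q} (e : C ≃ₗ[R] M) {P : Type*} [AddCommGroup P] [Module R P]
    (θ : maxColon C →ₗ[R] P) (hθ : Function.Surjective θ) (hθ0 : ∀ z, θ z = 0 ↔ (z : Q) ∈ C) :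
    Module.length R (ExtResidue R M 1) = Module.length R P := by
  obtain ⟨Θ, hΘ, hΘ0⟩ := exists_ext_one_map hR e
  have hker : LinearMap.ker Θ = LinearMap.ker θ := by
    ext z
    rw [LinearMap.mem_ker, LinearMap.mem_ker, hΘ0, hθ0]
  rw [← (Θ.quotKerEquivOfSurjective hΘ).length_eq, ← (θ.quotKerEquivOfSurjective hθ).length_eq,
    hker]

end ExtFractional

/-! ### Canonical modules are dualizing -/

section Canonical

variable {R : Type u} [CommRing R] [IsDomain R] [IsNoetherianRing R] [IsLocalRing R]
  [Ring.DimensionLEOne R] {Q : Type u} [Field Q] [Algebra R Q] [IsFractionRing R Q]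

/-- As `Ext²` vanishes, a map `𝔪 → Q/C` lifts to `Q`, where it is multiplication by an element. As
`Ext¹ = (C : 𝔪)/C` is nonzero, `Q/C` has a nonzero socle element. -/
lemma IsCanonicalModule.isDualizing (hR : maximalIdeal R ≠ ⊥) {ω : Type u} [AddCommGroup ω]
    [Module R ω] (hω : IsCanonicalModule R ω) {C : Submodule R Q} (e : C ≃ₗ[R] ω) :
    IsDualizing C := by
  apply isDualizing_of_exists
  · intro φ
    have h2 : Subsingleton (ExtResidue R ω 2) := by
      rw [← Module.length_eq_zero_iff (R := R), hω.length_ext 2]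
      rfl
    obtain ⟨ψ, hψ⟩ := exists_lift_of_ext_two h2 (C.subtype ∘ₗ e.symm.toLinearMap) C.mkQ
      (C.injective_subtype.comp e.symm.injective) C.mkQ_surjective (by
        rw [LinearMap.exact_iff, Submodule.ker_mkQ, LinearMap.range_comp, LinearEquiv.range,
          Submodule.map_top, Submodule.range_subtype]) φ
    obtain ⟨z, hz⟩ := exists_eq_smul_of_hom hR ψ
    refine ⟨C.mkQ z, fun r ↦ ?_⟩
    rw [← hψ, LinearMap.comp_apply, hz, map_smul]
  · obtain ⟨Θ, hΘ, hΘ0⟩ := exists_ext_one_map hR e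
    have h1 : Nontrivial (ExtResidue R ω 1) := by
      rw [← Module.length_pos_iff (R := R), hω.length_ext 1]
      simp
    obtain ⟨x, hx⟩ := exists_ne (0 : ExtResidue R ω 1)
    obtain ⟨z, rfl⟩ := hΘ x
    exact ⟨z, fun h ↦ hx ((hΘ0 z).mpr h), z.2⟩

end Canonical

/-! ### The total ring of fractions is a field -/

section TotalQuotientRing

variable (R : Type u) [CommRing R] [IsNoetherianRing R] [IsLocalRing R]

/-- A prime of `Q(R)` contracts to a prime without regular elements, which is not `𝔪` and hence is
minimal. So `Q(R)` is Noetherian of dimension zero. -/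
lemma isArtinianRing_fractionRing [Ring.KrullDimLE 1 R]
    (hCM : ∃ x ∈ maximalIdeal R, x ∈ nonZeroDivisors R) : IsArtinianRing (FractionRing R) := by
  have : IsNoetherianRing (FractionRing R) :=
    IsLocalization.isNoetherianRing (nonZeroDivisors R) _ inferInstance
  rw [isArtinianRing_iff_krullDimLE_zero, Ring.krullDimLE_zero_iff]
  intro P hP
  obtain ⟨P', hP', hle⟩ := Ideal.exists_le_maximal P hP.ne_top
  have hpr := hP'.isPrime
  have hmin : Ideal.comap (algebraMap R (FractionRing R)) P' ∈ minimalPrimes R := by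
    refine (Ring.krullDimLE_one_iff.mp ‹_› _
      (Ideal.comap_isPrime (algebraMap R (FractionRing R)) P')).resolve_right fun hmax ↦ ?_
    obtain ⟨x, hx, hx'⟩ := hCM
    rw [← eq_maximalIdeal hmax] at hx
    exact hP'.ne_top (Ideal.eq_top_of_isUnit_mem _ hx
      (IsLocalization.map_units (FractionRing R) ⟨x, hx'⟩))
  have h : Ideal.comap (algebraMap R (FractionRing R)) P' ≤
      Ideal.comap (algebraMap R (FractionRing R)) P :=
    hmin.2 ⟨Ideal.comap_isPrime _ _, bot_le⟩ (Ideal.comap_mono hle)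
  have h2 := Ideal.map_mono (f := algebraMap R (FractionRing R)) h
  rw [IsLocalization.map_under (nonZeroDivisors R), IsLocalization.map_under (nonZeroDivisors R)]
    at h2
  rwa [le_antisymm hle h2]

/-- The nilradical `N` of `Q(R)` is integral, hence a finitely generated `R`-module. A regular `a ∈
𝔪` is invertible in `Q(R)`, so `N = aN`, and Nakayama applies. -/
lemma eq_zero_of_isNilpotent_fractionRing (hCM : ∃ x ∈ maximalIdeal R, x ∈ nonZeroDivisors R)
    [Module.Finite R (Rbar R)] {x : FractionRing R} (hx : IsNilpotent x) : x = 0 := by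
  let N : Submodule R (FractionRing R) := (nilradical (FractionRing R)).restrictScalars R
  have hNV : N ≤ Subalgebra.toSubmodule (Rbar R) := by
    intro y hy
    obtain ⟨n, hn⟩ : IsNilpotent y := mem_nilradical.mp hy
    refine IsIntegral.of_pow (n := n + 1) n.succ_pos ?_
    rw [pow_succ, hn, zero_mul]
    exact isIntegral_zero
  have hVfg : (Subalgebra.toSubmodule (Rbar R)).FG := Module.Finite.iff_fg.mp ‹_›
  have hN : N.FG := Submodule.FG.of_le hVfg hNV
  obtain ⟨a, ha, ha'⟩ := hCM
  have h := Submodule.eq_bot_of_le_smul_of_le_jacobson_bot (maximalIdeal R) N hN (by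
    intro y hy
    obtain ⟨u, hu⟩ := IsLocalization.map_units (FractionRing R) ⟨a, ha'⟩
    have h1 : y = a • ((↑u⁻¹ : FractionRing R) * y) := by
      rw [Algebra.smul_def, ← mul_assoc, ← hu]
      simp
    rw [h1]
    exact Submodule.smul_mem_smul ha (Ideal.mul_mem_left _ _ hy)) (maximalIdeal_le_jacobson _)
  have hxN : x ∈ N := mem_nilradical.mpr hx
  rwa [h, Submodule.mem_bot] at hxN

/-- If the integral closure `R̄` is finite and local, then the total ring of fractions is a
field. -/
lemma isField_fractionRing [Ring.KrullDimLE 1 R]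
    (hCM : ∃ x ∈ maximalIdeal R, x ∈ nonZeroDivisors R)
    [Module.Finite R (Rbar R)] [IsLocalRing (Rbar R)] : IsField (FractionRing R) := by
  have := isArtinianRing_fractionRing R hCM
  refine ⟨exists_pair_ne _, mul_comm, fun {x} hx ↦ ?_⟩
  obtain ⟨n, y, hy⟩ := IsArtinian.exists_pow_succ_smul_dvd x (1 : FractionRing R)
  simp only [smul_eq_mul, mul_one] at hy
  have hpow : ∀ k : ℕ, x ^ n = x ^ n * x ^ k * y ^ k := by
    intro k
    induction k with
    | zero => simp
    | succ k ih =>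
      calc x ^ n = x ^ n * x ^ k * y ^ k := ih
        _ = (x ^ n.succ * y) * x ^ k * y ^ k := by rw [hy]
        _ = _ := by rw [pow_succ, pow_succ, pow_succ]; ring
  -- From `x^n = x^(n+1) y` this is an idempotent, so `0` or `1` in the local ring `R̄`. If `1`,
  -- then `x` is a unit; if `0`, then `x^n = x^n e = 0`.
  set e := x ^ n * y ^ n with he
  have hee : e * e = e := by
    calc e * e = x ^ n * x ^ n * y ^ n * y ^ n := by rw [he]; ring
      _ = e := by rw [← hpow n]
  have heV : IsIntegral R e := by
    refine ⟨Polynomial.X ^ 2 - Polynomial.X, Polynomial.monic_X_pow_sub (by simp), ?_⟩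
    simp [pow_two, hee]
  let ε : Rbar R := ⟨e, heV⟩
  have hε : ε * (1 - ε) = 0 := by
    ext
    change e * (1 - e) = 0
    rw [mul_sub, hee, mul_one, sub_self]
  rcases IsLocalRing.isUnit_or_isUnit_one_sub_self ε with hu | hu
  · have h1 : (1 : Rbar R) - ε = 0 := (hu.mul_right_eq_zero).mp hε
    have h2 : e = 1 := (congrArg Subtype.val (sub_eq_zero.mp h1)).symm
    refine ⟨y, ?_⟩
    have hux : IsUnit (x ^ n) := IsUnit.of_mul_eq_one _ (he ▸ h2)
    refine hux.mul_left_cancel ?_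
    rw [← mul_assoc, ← pow_succ, mul_one]
    exact hy
  · have h1 : ε = 0 := (hu.mul_left_eq_zero).mp hε
    have h2 : e = 0 := congrArg Subtype.val h1
    refine absurd (eq_zero_of_isNilpotent_fractionRing R hCM ⟨n, ?_⟩) hx
    have := hpow n
    rwa [mul_assoc, ← he, h2, mul_zero] at this

end TotalQuotientRing

/-! ### The integral closure is a discrete valuation ring -/

section DVR

variable {R : Type*} [CommRing R] [IsDomain R] [IsNoetherianRing R] [Ring.DimensionLEOne R]
  {Q : Type*} [Field Q] [Algebra R Q] [IsFractionRing R Q]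

lemma integralClosure_isDiscreteValuationRing (hR : ¬ IsField R)
    [Module.Finite R (integralClosure R Q)] [IsLocalRing (integralClosure R Q)] :
    IsDiscreteValuationRing (integralClosure R Q) := by
  have h1 : IsNoetherianRing (integralClosure R Q) := IsNoetherianRing.of_finite R _
  have h2 : IsFractionRing (integralClosure R Q) Q :=
    integralClosure.isFractionRing_of_finite_extension Q Q
  have h3 : IsIntegrallyClosed (integralClosure R Q) :=
    integralClosure.isIntegrallyClosedOfFiniteExtension Q
  have h4 : IsDedekindDomain (integralClosure R Q) := {}
  have hnf : ¬ IsField (integralClosure R Q) := fun h ↦ hR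
    (isField_of_isIntegral_of_isField
      (FaithfulSMul.algebraMap_injective R (integralClosure R Q)) h)
  exact ((IsDiscreteValuationRing.TFAE _ hnf).out 0 2).mpr h4

end DVR

/-! ### Lengths of quotients -/

section Length

variable {R : Type*} [CommRing R]

lemma length_quotient_map {M N : Type*} [AddCommGroup M] [Module R M] [AddCommGroup N] [Module R N]
    (h : M →ₗ[R] N) (hh : Function.Injective h) (A : Submodule R M) :
    Module.length R (N ⧸ A.map h) =
      Module.length R (M ⧸ A) + Module.length R (N ⧸ LinearMap.range h) := by
  have hle : A.map h ≤ LinearMap.range h := LinearMap.map_le_range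
  refine Module.length_eq_add_of_exact (A.mapQ (A.map h) h (Submodule.le_comap_map _ _))
    (Submodule.factor hle) ?_ (Submodule.factor_surjective hle) ?_
  · rw [← LinearMap.ker_eq_bot, Submodule.mapQ, Submodule.ker_liftQ_eq_bot']
    rw [LinearMap.ker_comp, Submodule.ker_mkQ, Submodule.comap_map_eq_of_injective hh]
  · rw [LinearMap.exact_iff, Submodule.range_mapQ, Submodule.factor, Submodule.mapQ,
      Submodule.ker_liftQ]
    rw [LinearMap.comp_id, Submodule.ker_mkQ]

lemma length_quotient_range_mulLeft {V : Type*} [CommRing V] [Algebra R V] (x : V) :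
    Module.length R (V ⧸ LinearMap.range (LinearMap.mulLeft R x)) =
      Module.length R (V ⧸ Ideal.span {x}) := by
  have h : LinearMap.range (LinearMap.mulLeft R x) = (Ideal.span {x}).restrictScalars R := by
    ext y
    simp only [LinearMap.mem_range, LinearMap.mulLeft_apply, Submodule.restrictScalars_mem,
      Ideal.mem_span_singleton]
    exact ⟨fun ⟨z, hz⟩ ↦ ⟨z, hz.symm⟩, fun ⟨z, hz⟩ ↦ ⟨z, hz.symm⟩⟩
  rw [h]
  exact (Submodule.Quotient.restrictScalarsEquiv R (Ideal.span {x})).length_eq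

end Length

/-! ### Multiplicity as the order of a reduction -/

section Multiplicity

variable {R : Type u} [CommRing R] [IsLocalRing R] {V : Type u} [CommRing V] [IsDomain V]
  [IsDiscreteValuationRing V] [Algebra R V]

lemma length_quotient_irreducible [IsLocalHom (algebraMap R V)]
    (hres : Function.Surjective (ResidueField.map (algebraMap R V))) {ϖ : V} (hϖ : Irreducible ϖ) :
    Module.length R (V ⧸ Ideal.span {ϖ}) = 1 := by
  have h1 : Ring.ord V ϖ = 1 := Ring.ord_of_irreducible hϖ
  rw [Ring.ord, Module.length_eq_of_surjective (R := V ⧸ Ideal.span {ϖ})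
    (by exact Ideal.Quotient.mk_surjective)] at h1
  rw [← h1]
  refine Module.length_eq_of_surjective fun y ↦ ?_
  obtain ⟨y, rfl⟩ := Ideal.Quotient.mk_surjective y
  obtain ⟨r, hr⟩ := hres (residue V y)
  obtain ⟨r, rfl⟩ := residue_surjective r
  rw [ResidueField.map_residue] at hr
  refine ⟨r, ?_⟩
  rw [IsScalarTower.algebraMap_apply R V (V ⧸ Ideal.span {ϖ})]
  refine Ideal.Quotient.eq.mpr ?_
  rw [← hϖ.maximalIdeal_eq]
  exact Ideal.Quotient.eq.mp hr

/-- When the residue fields of `R` and of the discrete valuation ring `V` agree, the length of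
`V / x V` over `R` is the order of `x`. -/
lemma length_quotient_eq_ord [IsLocalHom (algebraMap R V)]
    (hres : Function.Surjective (ResidueField.map (algebraMap R V))) {x : V} (hx : x ≠ 0) :
    Module.length R (V ⧸ Ideal.span {x}) = Ring.ord V x := by
  obtain ⟨ϖ, hϖ⟩ := IsDiscreteValuationRing.exists_irreducible V
  obtain ⟨n, hn⟩ := IsDiscreteValuationRing.associated_pow_irreducible hx hϖ
  rw [Ring.ord_eq_of_associated hn,
    Ideal.span_singleton_eq_span_singleton.mpr hn]
  clear hn
  induction n with
  | zero => simp
  | succ n ih =>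
    have hinj : Function.Injective (LinearMap.mulLeft R ϖ : V →ₗ[R] V) :=
      fun a b hab ↦ mul_left_cancel₀ hϖ.ne_zero hab
    have h := length_quotient_map (R := R) (LinearMap.mulLeft R ϖ) hinj
      (LinearMap.range (LinearMap.mulLeft R (ϖ ^ n)))
    rw [← LinearMap.range_comp, ← LinearMap.mulLeft_mul, ← pow_succ',
      length_quotient_range_mulLeft, length_quotient_range_mulLeft,
      length_quotient_range_mulLeft, length_quotient_irreducible hres hϖ, ih] at h
    rw [h, pow_succ, Ring.ord_mul _ (mem_nonZeroDivisors_of_ne_zero hϖ.ne_zero),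
      Ring.ord_of_irreducible hϖ]

/-- Write `𝔪^n V = bV`. The reduction equation puts `rb` in `abV`, and `b ≠ 0` cancels. -/
lemma algebraMap_dvd_of_reduction {a : R} (ha0 : algebraMap R V a ≠ 0) {n : ℕ}
    (h : maximalIdeal R ^ (n + 1) = Ideal.span {a} * maximalIdeal R ^ n) (ha : a ∈ maximalIdeal R)
    {r : R} (hr : r ∈ maximalIdeal R) : algebraMap R V a ∣ algebraMap R V r := by
  obtain ⟨b, hb⟩ := (inferInstance :
    ((maximalIdeal R ^ n).map (algebraMap R V)).IsPrincipal).principal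
  have hb' : (maximalIdeal R ^ n).map (algebraMap R V) = Ideal.span {b} := hb
  have hb0 : b ≠ 0 := by
    rintro rfl
    have h1 : algebraMap R V (a ^ n) ∈ (maximalIdeal R ^ n).map (algebraMap R V) :=
      Ideal.mem_map_of_mem _ (Ideal.pow_mem_pow ha n)
    rw [hb', map_pow] at h1
    exact pow_ne_zero n ha0 (by simpa using h1)
  have h1 : algebraMap R V r * b ∈ (maximalIdeal R ^ (n + 1)).map (algebraMap R V) := by
    rw [pow_succ', Ideal.map_mul]
    exact Ideal.mul_mem_mul (Ideal.mem_map_of_mem _ hr) (hb' ▸ Ideal.mem_span_singleton_self b)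
  rw [h, Ideal.map_mul, Ideal.map_span, Set.image_singleton, hb',
    Ideal.span_singleton_mul_span_singleton, Ideal.mem_span_singleton] at h1
  obtain ⟨c, hc⟩ := h1
  refine ⟨c, mul_right_cancel₀ hb0 ?_⟩
  rw [hc]
  ring

/-- The multiplicity of `R` is the order in `V` of a principal reduction of the maximal ideal. -/
lemma multiplicity_eq_ord [IsLocalHom (algebraMap R V)] (hinj : Function.Injective (algebraMap R V))
    (hres : Function.Surjective (ResidueField.map (algebraMap R V)))
    (hcond : ∃ d : R, d ≠ 0 ∧ ∀ v : V, ∃ r, algebraMap R V r = algebraMap R V d * v)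
    {a : R} (ha : a ∈ maximalIdeal R) (ha0 : a ≠ 0) {n : ℕ}
    (h : maximalIdeal R ^ (n + 1) = Ideal.span {a} * maximalIdeal R ^ n) :
    multiplicity R = (Ring.ord V (algebraMap R V a)).toNat := by
  have haV : algebraMap R V a ≠ 0 := by rwa [Ne, map_eq_zero_iff _ hinj]
  have hpow : ∀ k : ℕ, maximalIdeal R ^ (n + k) = Ideal.span {a ^ k} * maximalIdeal R ^ n := by
    intro k
    induction k with
    | zero => simp
    | succ k ih =>
      rw [← add_assoc, pow_succ', ih, mul_left_comm, ← pow_succ', h, ← mul_assoc,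
        Ideal.span_singleton_mul_span_singleton, ← pow_succ]
  have hfin : ∀ x : V, x ≠ 0 → Module.length R (V ⧸ Ideal.span {x}) ≠ ⊤ := by
    intro x hx
    rw [length_quotient_eq_ord hres hx]
    exact Ring.ord_ne_top (mem_nonZeroDivisors_of_ne_zero hx)
  let ι : R →ₗ[R] V := Algebra.linearMap R V
  have hι : Function.Injective ι := hinj
  -- Passing from `R/𝔪^k` to `V/𝔪^k` changes lengths by the constant `ℓ(V/R)`. In `V`, the equality
  -- `𝔪^(n+k) = a^k 𝔪^n` adds exactly `k v(a)` to the length.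
  let A : ℕ → Submodule R V := fun k ↦ Submodule.map ι (maximalIdeal R ^ k : Ideal R)
  have hA : ∀ k, Module.length R (V ⧸ A k) =
      Module.length R (R ⧸ maximalIdeal R ^ k) + Module.length R (V ⧸ LinearMap.range ι) :=
    fun k ↦ length_quotient_map ι hι _
  have hAmul : ∀ k, A (n + k) = (A n).map (LinearMap.mulLeft R (algebraMap R V (a ^ k))) := by
    intro k
    simp only [A, hpow k]
    ext y
    simp only [Submodule.mem_map, Ideal.mem_span_singleton_mul]
    constructor
    · rintro ⟨_, ⟨z, hz, rfl⟩, rfl⟩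
      exact ⟨ι z, ⟨z, hz, rfl⟩, by simp [ι]⟩
    · rintro ⟨_, ⟨z, hz, rfl⟩, rfl⟩
      exact ⟨a ^ k * z, ⟨z, hz, rfl⟩, by simp [ι]⟩
  set e := (Ring.ord V (algebraMap R V a)).toNat with he
  have he' : Ring.ord V (algebraMap R V a) = e :=
    (ENat.natCast_toNat (Ring.ord_ne_top (mem_nonZeroDivisors_of_ne_zero haV))).symm
  have hlen : ∀ k, Module.length R (V ⧸ A (n + k)) = Module.length R (V ⧸ A n) + k * e := by
    intro k
    have hk0 : algebraMap R V (a ^ k) ≠ 0 := by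
      rw [map_pow]
      exact pow_ne_zero k haV
    rw [hAmul, length_quotient_map _ (fun x y hxy ↦ mul_left_cancel₀ hk0 hxy),
      length_quotient_range_mulLeft, length_quotient_eq_ord hres hk0, map_pow,
      Ring.ord_pow (mem_nonZeroDivisors_of_ne_zero haV), he']
    simp
  -- The constants can be subtracted only if finite; this holds because `R` and `𝔪^n` contain
  -- nonzero multiples of `V`, namely `dV` and `a^n dV`.
  have hle : ∀ (B : Submodule R V) (x : R), x ≠ 0 →
      LinearMap.range (LinearMap.mulLeft R (algebraMap R V x)) ≤ B →
      Module.length R (V ⧸ B) ≠ ⊤ := by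
    intro B x hx hxB
    refine ne_top_of_le_ne_top ?_ (Module.length_le_of_surjective (Submodule.factor hxB)
      (Submodule.factor_surjective hxB))
    rw [length_quotient_range_mulLeft]
    exact hfin _ (by rwa [Ne, map_eq_zero_iff _ hinj])
  obtain ⟨d, hd0, hd⟩ := hcond
  have hVR : Module.length R (V ⧸ LinearMap.range ι) ≠ ⊤ := by
    refine hle _ d hd0 ?_
    rintro _ ⟨v, rfl⟩
    obtain ⟨r, hr⟩ := hd v
    exact ⟨r, hr⟩
  have : IsDomain R := hinj.isDomain (algebraMap R V)
  have hVA : Module.length R (V ⧸ A n) ≠ ⊤ := by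
    refine hle _ (a ^ n * d) (mul_ne_zero (pow_ne_zero n ha0) hd0) ?_
    rintro _ ⟨v, rfl⟩
    obtain ⟨r, hr⟩ := hd v
    refine ⟨a ^ n * r, Ideal.mul_mem_right _ _ (Ideal.pow_mem_pow ha n), ?_⟩
    simp [ι, hr]
  have hRn : Module.length R (R ⧸ maximalIdeal R ^ n) ≠ ⊤ := by
    intro htop
    rw [hA, htop, top_add] at hVA
    exact hVA rfl
  have key : ∀ k, (Module.length R (R ⧸ maximalIdeal R ^ (n + k))).toNat =
      (Module.length R (R ⧸ maximalIdeal R ^ n)).toNat + k * e := by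
    intro k
    have h1 := hlen k
    rw [hA, hA, add_right_comm] at h1
    have h2 := (WithTop.add_right_inj hVR).mp h1
    rw [h2, ENat.toNat_add hRn (by exact_mod_cast ENat.natCast_ne_top (k * e))]
    congr 1
  refine Filter.Tendsto.limUnder_eq ?_
  rw [← Filter.tendsto_add_atTop_iff_nat n]
  set c : ℝ := ((Module.length R (R ⧸ maximalIdeal R ^ n)).toNat : ℝ) with hc
  have h1 : Filter.Tendsto (fun k : ℕ ↦ (e : ℝ) + (c - n * e) / ((k + n : ℕ) : ℝ)) Filter.atTop
      (nhds ((e : ℝ) + 0)) := by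
    refine tendsto_const_nhds.add ?_
    exact (Filter.tendsto_add_atTop_iff_nat (f := fun k : ℕ ↦ (c - n * e) / (k : ℝ)) n).mpr
      (tendsto_const_div_atTop_nhds_zero_nat _)
  rw [add_zero] at h1
  refine h1.congr' ?_
  filter_upwards [Filter.eventually_gt_atTop 0] with k hk
  have hk' : ((k + n : ℕ) : ℝ) ≠ 0 := by positivity
  rw [add_comm k n, key k]
  rw [add_comm k n] at hk'
  field_simp
  push_cast
  ring

end Multiplicity

/-! ### Submodules of a valuation ring with prescribed orders -/

section Orders

variable {V : Type*} [CommRing V] [IsDomain V] [IsDiscreteValuationRing V]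

lemma ne_zero_of_ord_eq {x : V} {k : ℕ} (h : Ring.ord V x = k) : x ≠ 0 := by
  rintro rfl
  rw [Ring.ord_zero] at h
  have h1 : Module.length V V ≠ ⊤ := h ▸ ENat.natCast_ne_top k
  rw [Module.length_ne_top_iff, isFiniteLength_iff_isNoetherian_isArtinian] at h1
  have : IsArtinianRing V := h1.2
  exact IsDiscreteValuationRing.not_isField V (IsArtinianRing.isField_of_isDomain V)

lemma ord_irreducible_pow {ϖ : V} (hϖ : Irreducible ϖ) (k : ℕ) : Ring.ord V (ϖ ^ k) = k := by
  rw [Ring.ord_pow (mem_nonZeroDivisors_of_ne_zero hϖ.ne_zero), Ring.ord_of_irreducible hϖ]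
  simp

lemma associated_of_ord_eq {ϖ : V} (hϖ : Irreducible ϖ) {x : V} {k : ℕ} (h : Ring.ord V x = k) :
    Associated x (ϖ ^ k) := by
  obtain ⟨n, hn⟩ := IsDiscreteValuationRing.associated_pow_irreducible (ne_zero_of_ord_eq h) hϖ
  rw [Ring.ord_eq_of_associated hn, ord_irreducible_pow hϖ] at h
  rwa [← Nat.cast_injective h]

variable {R : Type*} [CommRing R] [IsLocalRing R] [Algebra R V] [IsLocalHom (algebraMap R V)]

/-- An `R`-submodule of `V` that contains elements of all orders below that of `a ∈ 𝔪` is `V`. -/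
lemma eq_top_of_forall_ord [Module.Finite R V]
    (hres : Function.Surjective (ResidueField.map (algebraMap R V))) {a : R}
    (ha : a ∈ maximalIdeal R) {e : ℕ} (he : Ring.ord V (algebraMap R V a) = e) (W : Submodule R V)
    (hW : ∀ k < e, ∃ g ∈ W, Ring.ord V g = k) : W = ⊤ := by
  obtain ⟨ϖ, hϖ⟩ := IsDiscreteValuationRing.exists_irreducible V
  -- Successive approximation: an element of `W` of order `k`, scaled by some `r ∈ R` with the right
  -- residue, removes the leading term of the remainder.
  have claim : ∀ k ≤ e, ∀ y : V, ∃ w ∈ W, ϖ ^ k ∣ y - w := by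
    intro k
    induction k with
    | zero => exact fun _ y ↦ ⟨0, W.zero_mem, by simp⟩
    | succ k ih =>
      intro hk y
      obtain ⟨w, hw, u, hu⟩ := ih (by omega) y
      obtain ⟨g, hg, hgk⟩ := hW k (by omega)
      obtain ⟨t, ht⟩ := (associated_of_ord_eq hϖ hgk).symm
      obtain ⟨r, hr⟩ := hres (residue V (u * ↑t⁻¹))
      obtain ⟨r, rfl⟩ := residue_surjective r
      rw [ResidueField.map_residue] at hr
      have hmem : u * ↑t⁻¹ - algebraMap R V r ∈ maximalIdeal V := by
        rw [← residue_eq_zero_iff, map_sub, hr, sub_self]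
      rw [hϖ.maximalIdeal_eq, Ideal.mem_span_singleton] at hmem
      obtain ⟨c, hc⟩ := hmem
      refine ⟨w + r • g, W.add_mem hw (W.smul_mem r hg), c * t, ?_⟩
      have h1 : u = (ϖ * c + algebraMap R V r) * t := by
        rw [← hc, sub_add_cancel, mul_assoc, Units.inv_mul, mul_one]
      rw [Algebra.smul_def, ← ht, ← sub_sub, hu, h1, pow_succ]
      ring
  rw [eq_top_iff]
  -- At `k = e` the remainder lies in `ϖ^e V = aV ⊆ 𝔪V`.
  refine Submodule.le_of_le_smul_of_le_jacobson_bot (I := maximalIdeal R) Module.Finite.fg_top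
    (maximalIdeal_le_jacobson _) ?_
  intro y _
  obtain ⟨w, hw, hdvd⟩ := claim e le_rfl y
  obtain ⟨c, hc⟩ := ((associated_of_ord_eq hϖ he).dvd).trans hdvd
  rw [← add_sub_cancel w y, hc, ← Algebra.smul_def]
  exact Submodule.add_mem_sup hw (Submodule.smul_mem_smul ha trivial)

end Orders

/-! ### Laurent coordinates on a semigroup ring -/

/-- An identification of the field `Q` with a field of Laurent series under which `R` becomes the
semigroup ring of a submonoid `Γ` of the natural numbers; `F` is the Frobenius number of `Γ`. -/
structure SemigroupCoordinates (R : Type*) [CommRing R] (Q : Type*) [Field Q] [Algebra R Q]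
    (K : Type*) [Field K] where
  /-- The identification with Laurent series. -/
  σ : Q ≃+* LaurentSeries K
  /-- The semigroup of exponents. -/
  Γ : AddSubmonoid ℤ
  /-- The Frobenius number. -/
  F : ℤ
  nonneg : ∀ h ∈ Γ, 0 ≤ h
  notMem : F ∉ Γ
  mem_of_lt : ∀ n, F < n → n ∈ Γ
  mem_one_iff : ∀ x : Q, x ∈ (1 : Submodule R Q) ↔ ∀ n, (σ x).coeff n ≠ 0 → n ∈ Γ

namespace SemigroupCoordinates

variable {R : Type*} [CommRing R] {Q : Type*} [Field Q] [Algebra R Q] {K : Type*} [Field K]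
  (S : SemigroupCoordinates R Q K)

/-- The coefficients of the Laurent expansion. -/
def cf (x : Q) (n : ℤ) : K := (S.σ x).coeff n

/-- The monomials `c t^n`. -/
def mon (n : ℤ) (c : K) : Q := S.σ.symm (HahnSeries.single n c)

@[simp] lemma cf_zero (n : ℤ) : S.cf 0 n = 0 := by simp [cf]

@[simp] lemma cf_add (x y : Q) (n : ℤ) : S.cf (x + y) n = S.cf x n + S.cf y n := by simp [cf]

@[simp] lemma cf_sub (x y : Q) (n : ℤ) : S.cf (x - y) n = S.cf x n - S.cf y n := by simp [cf]

lemma cf_sum {ι : Type*} (s : Finset ι) (f : ι → Q) (n : ℤ) :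
    S.cf (∑ i ∈ s, f i) n = ∑ i ∈ s, S.cf (f i) n := by
  induction s using Finset.cons_induction with
  | empty => simp
  | cons a s ha ih => simp [ih]

lemma cf_mon (m : ℤ) (c : K) (n : ℤ) : S.cf (S.mon m c) n = if n = m then c else 0 := by
  simp [cf, mon, HahnSeries.coeff_single]

lemma cf_mon_mul (m : ℤ) (c : K) (x : Q) (n : ℤ) :
    S.cf (S.mon m c * x) n = c * S.cf x (n - m) := by
  simp [cf, mon, HahnSeries.coeff_single_mul]

lemma mon_mul_mon (m n : ℤ) (c d : K) : S.mon m c * S.mon n d = S.mon (m + n) (c * d) := by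
  rw [mon, mon, ← map_mul, HahnSeries.single_mul_single, mon]

lemma mon_zero_one : S.mon 0 1 = 1 := by
  rw [mon, HahnSeries.single_zero_one, map_one]

lemma mon_ne_zero (n : ℤ) {c : K} (hc : c ≠ 0) : S.mon n c ≠ 0 := by
  intro h
  have := S.cf_mon n c n
  simp [h] at this
  exact hc this.symm

lemma mon_pow (n : ℕ) : S.mon 1 1 ^ n = S.mon n 1 := by
  induction n with
  | zero => simp [mon_zero_one]
  | succ n ih => rw [pow_succ, ih, mon_mul_mon, mul_one, Nat.cast_succ]

lemma exists_of_cf_mul_ne_zero {x y : Q} {n : ℤ} (h : S.cf (x * y) n ≠ 0) :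
    ∃ a b, a + b = n ∧ S.cf x a ≠ 0 ∧ S.cf y b ≠ 0 := by
  rw [cf, map_mul, HahnSeries.coeff_mul] at h
  obtain ⟨⟨a, b⟩, hab, hne⟩ := Finset.exists_ne_zero_of_sum_ne_zero h
  exact ⟨a, b, (Finset.mem_antidiagonal.mp hab).2.2, left_ne_zero_of_mul hne,
    right_ne_zero_of_mul hne⟩

lemma algebraMap_mem (r : R) {n : ℤ} (h : S.cf (algebraMap R Q r) n ≠ 0) : n ∈ S.Γ :=
  (S.mem_one_iff _).mp (Submodule.algebraMap_mem r) n h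

lemma exists_algebraMap {x : Q} (h : ∀ n, S.cf x n ≠ 0 → n ∈ S.Γ) : ∃ r, algebraMap R Q r = x :=
  Submodule.mem_one.mp ((S.mem_one_iff x).mpr h)

lemma exists_algebraMap_mon {n : ℤ} (hn : n ∈ S.Γ) (c : K) :
    ∃ r, algebraMap R Q r = S.mon n c := by
  refine S.exists_algebraMap fun m hm ↦ ?_
  rw [cf_mon] at hm
  rwa [(ite_ne_right_iff.mp hm).1]

lemma neg_one_le_F : -1 ≤ S.F := by
  by_contra h
  have := S.nonneg (-1) (S.mem_of_lt _ (by omega))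
  omega

/-- In the convolution only the constant term of `r` survives. This makes the constant coefficient
multiplicative, and certain coefficient maps `R`-linear. -/
lemma cf_mul_of_forall {r : R} {x : Q} {n : ℤ}
    (h : ∀ a ∈ S.Γ, a ≠ 0 → S.cf x (n - a) = 0) :
    S.cf (r • x) n = S.cf (algebraMap R Q r) 0 * S.cf x n := by
  rw [Algebra.smul_def]
  set y := algebraMap R Q r with hy
  have h1 : y = S.mon 0 (S.cf y 0) + (y - S.mon 0 (S.cf y 0)) := by ring
  have h2 : S.cf ((y - S.mon 0 (S.cf y 0)) * x) n = 0 := by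
    by_contra hne
    obtain ⟨a, b, hab, ha, hb⟩ := S.exists_of_cf_mul_ne_zero hne
    rw [cf_sub, cf_mon] at ha
    have ha0 : a ≠ 0 := by
      rintro rfl
      simp at ha
    rw [if_neg ha0, sub_zero] at ha
    refine hb ?_
    rw [← h a (S.algebraMap_mem r ha) ha0]
    congr 1
    omega
  conv_lhs => rw [h1, add_mul, cf_add, h2, add_zero, cf_mon_mul, sub_zero]

/-- The constant coefficient. -/
def constCoeff : R →+* K where
  toFun r := S.cf (algebraMap R Q r) 0
  map_one' := by
    rw [map_one, ← S.mon_zero_one, cf_mon, if_pos rfl]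
  map_zero' := by simp
  map_add' a b := by simp
  map_mul' a b := by
    rw [map_mul, ← Algebra.smul_def, S.cf_mul_of_forall]
    intro h hh h0
    by_contra hne
    have h1 := S.nonneg _ (S.algebraMap_mem b hne)
    have h2 := S.nonneg h hh
    omega

lemma constCoeff_surjective : Function.Surjective S.constCoeff := by
  intro c
  obtain ⟨r, hr⟩ := S.exists_algebraMap_mon S.Γ.zero_mem c
  exact ⟨r, by change S.cf _ 0 = c; rw [hr, cf_mon, if_pos rfl]⟩

lemma mem_maximalIdeal_iff [IsLocalRing R] {r : R} :
    r ∈ maximalIdeal R ↔ S.cf (algebraMap R Q r) 0 = 0 := by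
  have := RingHom.ker_isMaximal_of_surjective S.constCoeff S.constCoeff_surjective
  rw [← eq_maximalIdeal this]
  rfl

lemma exists_maximalIdeal_mon [IsLocalRing R] {n : ℤ} (hn : n ∈ S.Γ) (h0 : n ≠ 0) :
    ∃ r ∈ maximalIdeal R, algebraMap R Q r = S.mon n 1 := by
  obtain ⟨r, hr⟩ := S.exists_algebraMap_mon hn 1
  refine ⟨r, ?_, hr⟩
  rw [S.mem_maximalIdeal_iff, hr, cf_mon, if_neg h0.symm]

/-- The series with exponents in a `Γ`-stable set. -/
def supported (A : Set ℤ) (hA : ∀ h ∈ S.Γ, ∀ a ∈ A, h + a ∈ A) : Submodule R Q where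
  carrier := {x | ∀ n, S.cf x n ≠ 0 → n ∈ A}
  zero_mem' n hn := by simp at hn
  add_mem' {x y} hx hy n hn := by
    by_cases h : S.cf x n = 0
    · exact hy n (by simpa [h] using hn)
    · exact hx n h
  smul_mem' r x hx n hn := by
    rw [Algebra.smul_def] at hn
    obtain ⟨a, b, rfl, ha, hb⟩ := S.exists_of_cf_mul_ne_zero hn
    exact hA a (S.algebraMap_mem r ha) b (hx b hb)

lemma cf_ne_zero_order {x : Q} (hx : x ≠ 0) : S.cf x (S.σ x).order ≠ 0 := by
  rw [cf, Ne, HahnSeries.coeff_order_eq_zero]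
  simpa using hx

lemma order_inv {x : Q} (hx : x ≠ 0) : (S.σ x⁻¹).order = -(S.σ x).order := by
  have h := HahnSeries.order_mul (x := S.σ x) (y := S.σ x⁻¹) (by simpa using hx) (by simpa using hx)
  rw [← map_mul, mul_inv_cancel₀ hx, map_one, HahnSeries.order_one] at h
  omega

section IntegralClosure

variable [IsDomain R] [IsNoetherianRing R] [IsFractionRing R Q]

/-- The powers of an integral `x` have a common denominator `d`, so `ord d + k ord x ≥ 0` for all
`k`, which forces `ord x ≥ 0`. Conversely, the series without negative exponents form a ring inside
the cyclic module `R t^(-(F+1))`, so they are integral. -/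
lemma mem_integralClosure_iff {x : Q} :
    x ∈ integralClosure R Q ↔ ∀ n, S.cf x n ≠ 0 → 0 ≤ n := by
  constructor
  · intro hx n hn
    have hx0 : x ≠ 0 := by
      rintro rfl
      simp at hn
    obtain ⟨d, hd, hdx⟩ := FractionalIdeal.isFractional_adjoin_integral (nonZeroDivisors R) x hx
    have hd0 : algebraMap R Q d ≠ 0 := by
      simpa using nonZeroDivisors.ne_zero hd
    have hpow : ∀ k : ℕ, 0 ≤ (S.σ (algebraMap R Q d)).order + k • (S.σ x).order := by
      intro k
      obtain ⟨r, hr⟩ := hdx (x ^ k) (pow_mem (Algebra.self_mem_adjoin_singleton R x) k)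
      rw [Algebra.smul_def] at hr
      have hne : algebraMap R Q d * x ^ k ≠ 0 := mul_ne_zero hd0 (pow_ne_zero k hx0)
      have h1 := S.cf_ne_zero_order hne
      have h2 : 0 ≤ (S.σ (algebraMap R Q d * x ^ k)).order := by
        refine S.nonneg _ (S.algebraMap_mem r ?_)
        rw [hr]
        exact h1
      rwa [map_mul, map_pow, HahnSeries.order_mul (by simpa using hd0)
        (pow_ne_zero k (by simpa using hx0)), HahnSeries.order_pow] at h2
    have hord : 0 ≤ (S.σ x).order := by
      by_contra hneg
      have h1 := hpow ((S.σ (algebraMap R Q d)).order.toNat + 1)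
      simp only [nsmul_eq_mul, Nat.cast_add, Nat.cast_one] at h1
      have h2 := Int.self_le_toNat (S.σ (algebraMap R Q d)).order
      nlinarith
    exact hord.trans (HahnSeries.order_le_of_coeff_ne_zero hn)
  · intro hx
    let V : Subalgebra R Q :=
      { S.supported {n | 0 ≤ n} (fun h hh a ha ↦ add_nonneg (S.nonneg h hh) ha) with
        mul_mem' := fun {x y} hx hy n hn ↦ by
          obtain ⟨a, b, rfl, ha, hb⟩ := S.exists_of_cf_mul_ne_zero hn
          exact Int.add_nonneg (hx a ha) (hy b hb)
        algebraMap_mem' := fun r n hn ↦ S.nonneg n (S.algebraMap_mem r hn) }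
    have hV : Subalgebra.toSubmodule V ≤ Submodule.span R {S.mon (-(S.F + 1)) 1} := by
      intro y hy
      obtain ⟨r, hr⟩ := S.exists_algebraMap (x := S.mon (S.F + 1) 1 * y) (fun n hn ↦ by
        rw [cf_mon_mul, one_mul] at hn
        have : 0 ≤ n - (S.F + 1) := hy _ hn
        exact S.mem_of_lt n (by omega))
      refine Submodule.mem_span_singleton.mpr ⟨r, ?_⟩
      rw [Algebra.smul_def, hr, mul_right_comm, mon_mul_mon, add_neg_cancel, mul_one,
        mon_zero_one, one_mul]
    have hfg : (Subalgebra.toSubmodule V).FG :=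
      Submodule.FG.of_le (Submodule.fg_span_singleton _) hV
    exact IsIntegral.of_mem_of_fg V hfg x hx

lemma mon_mem_integralClosure {n : ℤ} (hn : 0 ≤ n) (c : K) : S.mon n c ∈ integralClosure R Q := by
  rw [S.mem_integralClosure_iff]
  intro m hm
  rw [cf_mon] at hm
  rwa [(ite_ne_right_iff.mp hm).1]

lemma irreducible_mon_one :
    Irreducible (⟨S.mon 1 1, S.mon_mem_integralClosure zero_le_one 1⟩ : integralClosure R Q) := by
  have hmem : ∀ {x : Q}, x ≠ 0 → (x ∈ integralClosure R Q ↔ 0 ≤ (S.σ x).order) := by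
    intro x hx
    rw [S.mem_integralClosure_iff]
    exact ⟨fun h ↦ h _ (S.cf_ne_zero_order hx),
      fun h n hn ↦ h.trans (HahnSeries.order_le_of_coeff_ne_zero hn)⟩
  have hunit : ∀ x : integralClosure R Q, (x : Q) ≠ 0 → (S.σ (x : Q)).order = 0 → IsUnit x := by
    intro x hx h0
    refine IsUnit.of_mul_eq_one
      ⟨(x : Q)⁻¹, (hmem (inv_ne_zero hx)).mpr (by rw [S.order_inv hx, h0, neg_zero])⟩ ?_
    ext
    exact mul_inv_cancel₀ hx
  have h1 : (S.σ (S.mon 1 1)).order = 1 := by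
    rw [mon, RingEquiv.apply_symm_apply]
    exact HahnSeries.order_single one_ne_zero
  refine ⟨fun hu ↦ ?_, ?_⟩
  · obtain ⟨y, hy⟩ := hu.exists_right_inv
    have hy' : S.mon 1 1 * (y : Q) = 1 := congrArg Subtype.val hy
    have hy0 : (y : Q) ≠ 0 := right_ne_zero_of_mul (hy' ▸ one_ne_zero)
    have h2 := (hmem hy0).mp y.2
    have h3 : (y : Q) = (S.mon 1 1)⁻¹ := eq_inv_of_mul_eq_one_right hy'
    rw [h3, S.order_inv (S.mon_ne_zero 1 one_ne_zero), h1] at h2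
    omega
  · intro x y hxy
    have hxy' : S.mon 1 1 = (x : Q) * y := congrArg Subtype.val hxy
    have hne : (x : Q) * y ≠ 0 := hxy' ▸ S.mon_ne_zero 1 one_ne_zero
    have hx0 := left_ne_zero_of_mul hne
    have hy0 := right_ne_zero_of_mul hne
    rw [hxy', map_mul, HahnSeries.order_mul (by simpa using hx0) (by simpa using hy0)] at h1
    have hx2 := (hmem hx0).mp x.2
    have hy2 := (hmem hy0).mp y.2
    by_cases h : (S.σ (x : Q)).order = 0
    · exact Or.inl (hunit x hx0 h)
    · exact Or.inr (hunit y hy0 (by omega))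

lemma ord_mon [IsDiscreteValuationRing (integralClosure R Q)] (n : ℕ) :
    Ring.ord (integralClosure R Q)
      ⟨S.mon n 1, S.mon_mem_integralClosure (Int.natCast_nonneg n) 1⟩ = n := by
  rw [← ord_irreducible_pow S.irreducible_mon_one n]
  congr 1
  ext
  exact (S.mon_pow n).symm

end IntegralClosure

end SemigroupCoordinates

/-! ### Recognizing canonical modules -/

section Cyclic

variable {R : Type*} [CommRing R] [IsLocalRing R]
  {Q : Type*} [Field Q] [Algebra R Q]

/-- Let `C` be dualizing. A fractional ideal `C₀` such that there is no submodule strictly between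
`C₀` and `C₀ : 𝔪` is isomorphic to `C`. -/
lemma IsDualizing.nonempty_linearEquiv {C : Submodule R Q} (hC : IsDualizing C)
    (hmax : maximalIdeal R ≠ ⊥) (hinj : Function.Injective (algebraMap R Q))
    {C₀ : Submodule R Q} (hC₀ : IsFractional (nonZeroDivisors R) C₀) (hC₀0 : C₀ ≠ ⊥)
    (hJfg : (C / C₀).FG) (hJfrac : IsFractional (nonZeroDivisors R) (C / C₀)) (hJ0 : C / C₀ ≠ ⊥)
    (hsimple : ∀ N : Submodule R Q, C₀ ≤ N → N ≤ maxColon C₀ → N ≠ C₀ → N = maxColon C₀) :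
    Nonempty (C₀ ≃ₗ[R] C) := by
  -- It suffices that `J` is cyclic: if `J = Ry`, then multiplication by `y` maps `C₀ = C : J` onto
  -- `C`.
  set J := C / C₀ with hJ
  have hbi : C / J = C₀ := hC.div_div hC₀ hC₀0
  have hmJ : maximalIdeal R • J ≤ J := Submodule.smul_le_right
  obtain ⟨y, hyJ, hym⟩ : ∃ y ∈ J, y ∉ maximalIdeal R • J := by
    by_contra! h
    exact hJ0 (Submodule.eq_bot_of_le_smul_of_le_jacobson_bot (maximalIdeal R) J hJfg h
      (maximalIdeal_le_jacobson _))
  have hmJ0 : maximalIdeal R • J ≠ ⊥ := by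
    obtain ⟨a, ha, ha0⟩ := Submodule.exists_mem_ne_zero_of_ne_bot hmax
    obtain ⟨j, hj, hj0⟩ := Submodule.exists_mem_ne_zero_of_ne_bot hJ0
    intro h
    have h1 : a • j ∈ maximalIdeal R • J := Submodule.smul_mem_smul ha hj
    rw [h, Submodule.mem_bot, Algebra.smul_def, mul_eq_zero, map_eq_zero_iff _ hinj] at h1
    exact h1.elim ha0 hj0
  set I := Submodule.span R {y} ⊔ maximalIdeal R • J with hI
  have hIJ : I ≤ J := sup_le ((Submodule.span_singleton_le_iff_mem _ _).mpr hyJ) hmJ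
  have hmI : maximalIdeal R • J ≤ I := le_sup_right
  have hle : C / (maximalIdeal R • J) ≤ maxColon C₀ := by
    intro z hz r hr
    rw [← hbi, Submodule.mem_div_iff_forall_mul_mem]
    intro j hj
    have := Submodule.mem_div_iff_forall_mul_mem.mp hz _ (Submodule.smul_mem_smul hr hj)
    rwa [mul_smul_comm, ← smul_mul_assoc] at this
  -- `C : I` lies between `C₀` and `C₀ : 𝔪`. Were it the larger, duality would give `I ⊆ 𝔪J`,
  -- against the choice of `y`; being the smaller, it gives `J ⊆ I`, and Nakayama yields `J = Ry`.
  have hCI : C / I = C₀ := by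
    by_contra hne
    have h1 := hsimple (C / I) (hbi ▸ div_anti C hIJ) ((div_anti C hmI).trans hle) hne
    have h2 := hC _ I (isFractional_mono hmJ hJfrac) hmJ0 (h1 ▸ hle)
    exact hym (h2 (Submodule.mem_sup_left (Submodule.mem_span_singleton_self y)))
  have hJI : J ≤ I := hC I J (isFractional_mono hIJ hJfrac)
    (fun h ↦ hmJ0 (le_bot_iff.mp (h ▸ hmI))) (hCI.trans hbi.symm).le
  have hJy : J ≤ Submodule.span R {y} :=
    Submodule.le_of_le_smul_of_le_jacobson_bot hJfg (maximalIdeal_le_jacobson _) hJI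
  have hy0 : y ≠ 0 := by
    rintro rfl
    exact hym (Submodule.zero_mem _)
  have hmem : ∀ x : Q, x ∈ C₀ ↔ x * y ∈ C := by
    intro x
    rw [← hbi, Submodule.mem_div_iff_forall_mul_mem]
    refine ⟨fun h ↦ h y hyJ, fun h j hj ↦ ?_⟩
    obtain ⟨r, rfl⟩ := Submodule.mem_span_singleton.mp (hJy hj)
    rw [mul_smul_comm]
    exact C.smul_mem r h
  exact ⟨{
    toFun := fun x ↦ ⟨x * y, (hmem x).mp x.2⟩
    map_add' := fun a b ↦ Subtype.ext (add_mul _ _ _)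
    map_smul' := fun r a ↦ Subtype.ext (smul_mul_assoc r (a : Q) y)
    invFun := fun x ↦ ⟨x * y⁻¹, (hmem _).mpr (by simp [hy0])⟩
    left_inv := fun x ↦ Subtype.ext (by simp [hy0])
    right_inv := fun x ↦ Subtype.ext (by simp [hy0]) }⟩

end Cyclic

/-! ### The standard canonical module of a semigroup ring -/

namespace SemigroupCoordinates

variable {R : Type*} [CommRing R] {Q : Type*} [Field Q] [Algebra R Q] {K : Type*} [Field K]
  (S : SemigroupCoordinates R Q K)

/-- The exponents of the standard canonical module of a semigroup ring. -/
def canonicalSet : Set ℤ := {n | ∀ h ∈ S.Γ, n + h ≠ S.F}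

lemma add_mem_canonicalSet : ∀ h ∈ S.Γ, ∀ a ∈ S.canonicalSet, h + a ∈ S.canonicalSet := by
  intro h hh a ha h' hh' heq
  exact ha (h + h') (S.Γ.add_mem hh hh') (by omega)

/-- The standard canonical module of a semigroup ring. -/
def canonical : Submodule R Q := S.supported S.canonicalSet S.add_mem_canonicalSet

lemma zero_mem_canonicalSet : (0 : ℤ) ∈ S.canonicalSet := by
  intro h hh heq
  rw [zero_add] at heq
  exact S.notMem (heq ▸ hh)

lemma nonneg_of_mem_canonicalSet {n : ℤ} (hn : n ∈ S.canonicalSet) : 0 ≤ n := by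
  by_contra hneg
  exact hn (S.F - n) (S.mem_of_lt _ (by omega)) (by omega)

lemma mon_mem_canonical {n : ℤ} (hn : n ∈ S.canonicalSet) (c : K) : S.mon n c ∈ S.canonical := by
  intro m hm
  rw [cf_mon] at hm
  rwa [(ite_ne_right_iff.mp hm).1]

lemma one_le_canonical : 1 ≤ S.canonical := by
  rw [Submodule.one_le, ← S.mon_zero_one]
  exact S.mon_mem_canonical S.zero_mem_canonicalSet 1

lemma canonical_le [IsDomain R] [IsNoetherianRing R] [IsFractionRing R Q] :
    S.canonical ≤ Subalgebra.toSubmodule (integralClosure R Q) := by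
  intro x hx
  exact S.mem_integralClosure_iff.mpr fun n hn ↦ S.nonneg_of_mem_canonicalSet (hx n hn)

/-- A forbidden exponent `n = F - a` of `x` has `a ≠ 0`, so `t^a x` lies in the module but has the
exponent `F`, which is never allowed. -/
lemma mem_canonical_of_mem_maxColon [IsLocalRing R] {x : Q} (hx : x ∈ maxColon S.canonical)
    (h : S.cf x S.F = 0) : x ∈ S.canonical := by
  intro n hn a ha heq
  have ha0 : a ≠ 0 := by
    rintro rfl
    rw [add_zero] at heq
    exact hn (heq ▸ h)
  obtain ⟨r, hr, hrt⟩ := S.exists_maximalIdeal_mon ha ha0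
  refine hx r hr (n + a) ?_ 0 S.Γ.zero_mem (by omega)
  rw [Algebra.smul_def, hrt, cf_mon_mul, one_mul, add_sub_cancel_right]
  exact hn

/-- The coefficient at `F` embeds `(C₀ : 𝔪)/C₀` in `K`, where `C₀` is the standard module, and
scalars of `K` come from `R`. -/
lemma eq_maxColon_canonical [IsLocalRing R] (N : Submodule R Q) (h1 : S.canonical ≤ N)
    (h2 : N ≤ maxColon S.canonical) (h3 : N ≠ S.canonical) : N = maxColon S.canonical := by
  obtain ⟨x, hxN, hx⟩ := SetLike.not_le_iff_exists.mp fun h ↦ h3 (le_antisymm h h1)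
  have hxF : S.cf x S.F ≠ 0 := fun h ↦ hx (S.mem_canonical_of_mem_maxColon (h2 hxN) h)
  refine le_antisymm h2 fun y hy ↦ ?_
  obtain ⟨r, hr⟩ := S.exists_algebraMap_mon S.Γ.zero_mem (S.cf y S.F / S.cf x S.F)
  have h : y - r • x ∈ S.canonical := by
    refine S.mem_canonical_of_mem_maxColon (sub_mem hy (Submodule.smul_mem _ r (h2 hxN))) ?_
    rw [cf_sub, Algebra.smul_def, hr, cf_mon_mul, sub_zero, div_mul_cancel₀ _ hxF, sub_self]
  rw [← sub_add_cancel y (r • x)]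
  exact add_mem (h1 h) (N.smul_mem r hxN)

/-- The exponents of the minimal generators of the canonical module. -/
def generatorSet : Set ℤ := {n | n ∈ S.canonicalSet ∧ ∀ h ∈ S.Γ, h ≠ 0 → n - h ∉ S.canonicalSet}

lemma generatorSet_finite : S.generatorSet.Finite := by
  -- An `n > F + 1` is a nonzero element of `Γ`, and `n - n = 0` is in the set. The bound `F` would
  -- fail for `F = -1`, where `0` is a generator.
  refine (Set.finite_Icc 0 (S.F + 1)).subset fun n hn ↦
    ⟨S.nonneg_of_mem_canonicalSet hn.1, ?_⟩
  by_contra hlt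
  have h1 := S.neg_one_le_F
  refine hn.2 n (S.mem_of_lt n (by omega)) (by omega) ?_
  rw [sub_self]
  exact S.zero_mem_canonicalSet

lemma exists_generator_add {n : ℤ} (hn : n ∈ S.canonicalSet) :
    ∃ g ∈ S.generatorSet, ∃ h ∈ S.Γ, n = g + h := by
  induction hk : n.toNat using Nat.strong_induction_on generalizing n with
  | _ k ih =>
  by_cases hg : n ∈ S.generatorSet
  · exact ⟨n, hg, 0, S.Γ.zero_mem, (add_zero n).symm⟩
  · have : ∃ h ∈ S.Γ, h ≠ 0 ∧ n - h ∈ S.canonicalSet := by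
      by_contra! hcon
      exact hg ⟨hn, hcon⟩
    obtain ⟨h, hh, h0, hmem⟩ := this
    have h1 := S.nonneg_of_mem_canonicalSet hmem
    have h2 := S.nonneg h hh
    obtain ⟨g, hg, h', hh', heq⟩ := ih (n - h).toNat (by omega) hmem rfl
    exact ⟨g, hg, h' + h, S.Γ.add_mem hh' hh, by omega⟩

/-- The terms with exponents in `[0, F]` are finitely many multiples of generators; the rest of the
series has exponents above `F` and lies in `R = R t^0`. -/
lemma canonical_eq_span : S.canonical = Submodule.span R ((fun n ↦ S.mon n 1) '' S.generatorSet) := by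
  refine le_antisymm (fun x hx ↦ ?_) (Submodule.span_le.mpr ?_)
  · set N := Submodule.span R ((fun n ↦ S.mon n 1) '' S.generatorSet) with hN
    have hmon : ∀ n ∈ S.canonicalSet, ∀ c, S.mon n c ∈ N := by
      intro n hn c
      obtain ⟨g, hg, h, hh, rfl⟩ := S.exists_generator_add hn
      obtain ⟨r, hr⟩ := S.exists_algebraMap_mon hh c
      have : S.mon (g + h) c = r • S.mon g 1 := by
        rw [Algebra.smul_def, hr, mon_mul_mon, mul_one, add_comm]
      rw [this]
      exact N.smul_mem r (Submodule.subset_span ⟨g, hg, rfl⟩)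
    have hsum : ∑ n ∈ Finset.Icc 0 S.F, S.mon n (S.cf x n) ∈ N := by
      refine N.sum_mem fun n _ ↦ ?_
      by_cases h : S.cf x n = 0
      · simp [h, mon]
      · exact hmon n (hx n h) _
    obtain ⟨r, hr⟩ := S.exists_algebraMap (x := x - ∑ n ∈ Finset.Icc 0 S.F, S.mon n (S.cf x n))
      (fun n hn ↦ by
        apply S.mem_of_lt
        by_contra hle
        refine hn ?_
        rw [cf_sub, cf_sum]
        simp only [cf_mon, Finset.sum_ite_eq, Finset.mem_Icc]
        split_ifs with h
        · exact sub_self _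
        · rw [sub_zero]
          by_contra hne
          exact h ⟨S.nonneg_of_mem_canonicalSet (hx n hne), by omega⟩)
    have h1 : (1 : Q) ∈ N := by
      rw [← S.mon_zero_one]
      exact hmon 0 S.zero_mem_canonicalSet 1
    rw [← sub_add_cancel x (∑ n ∈ Finset.Icc 0 S.F, S.mon n (S.cf x n)), ← hr,
      Algebra.algebraMap_eq_smul_one]
    exact N.add_mem (N.smul_mem r h1) hsum
  · rintro _ ⟨n, hn, rfl⟩
    exact S.mon_mem_canonical hn.1 1

/-- The product of the canonical module with itself only involves sums of two generators and an
element of the semigroup. -/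
lemma exists_of_mon_mem_canonical_mul {n : ℤ} (h : S.mon n 1 ∈ S.canonical * S.canonical) :
    ∃ g ∈ S.generatorSet, ∃ g' ∈ S.generatorSet, ∃ a ∈ S.Γ, n = g + g' + a := by
  have hle : S.canonical * S.canonical ≤
      S.supported {n | ∃ a ∈ S.canonicalSet, ∃ b ∈ S.canonicalSet, a + b = n} (by
        rintro h hh _ ⟨a, ha, b, hb, rfl⟩
        exact ⟨h + a, S.add_mem_canonicalSet h hh a ha, b, hb, by ring⟩) := by
    rw [Submodule.mul_le]
    intro x hx y hy n hn
    obtain ⟨a, b, rfl, ha, hb⟩ := S.exists_of_cf_mul_ne_zero hn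
    exact ⟨a, hx a ha, b, hy b hb, rfl⟩
  obtain ⟨a, ha, b, hb, rfl⟩ := hle h n (by rw [cf_mon, if_pos rfl]; exact one_ne_zero)
  obtain ⟨g, hg, b, hb', rfl⟩ := S.exists_generator_add ha
  obtain ⟨g', hg', b', hb'', rfl⟩ := S.exists_generator_add hb
  exact ⟨g, hg, g', hg', b + b', S.Γ.add_mem hb' hb'', by ring⟩

end SemigroupCoordinates

/-! ### The type of a semigroup ring -/

section CMType

variable {R : Type u} [CommRing R] [IsLocalRing R] {Q : Type*} [Field Q] [Algebra R Q]
  [IsFractionRing R Q] {K : Type*} [Field K] (S : SemigroupCoordinates R Q K)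

/-- The type of a semigroup ring is the number of generators of its canonical module. -/
lemma SemigroupCoordinates.cmType_eq (hR : maximalIdeal R ≠ ⊥) {r : ℕ} (n : Fin r → ℤ)
    (hn : Function.Injective n) (hrange : Set.range n = S.generatorSet) : cmType R = r := by
  let : Algebra R K := S.constCoeff.toAlgebra
  have hK : Module.length R K = 1 := by
    rw [Module.length_eq_of_surjective (R := K) S.constCoeff_surjective, Module.length_eq_one]
  have hgen : ∀ i, n i ∈ S.generatorSet := fun i ↦ hrange ▸ ⟨i, rfl⟩
  have hcolon : ∀ z ∈ maxColon (1 : Submodule R Q), ∀ m a, S.cf z m ≠ 0 → a ∈ S.Γ → a ≠ 0 →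
      m + a ∈ S.Γ := by
    intro z hz m a hm ha ha0
    obtain ⟨s, hs, hst⟩ := S.exists_maximalIdeal_mon ha ha0
    refine (S.mem_one_iff _).mp (hz s hs) (m + a) ?_
    change S.cf _ _ ≠ 0
    rwa [Algebra.smul_def, hst, S.cf_mon_mul, one_mul, add_sub_cancel_right]
  -- The numbers `F - n i` are the pseudo-Frobenius numbers: they are outside `Γ`, but adding any
  -- nonzero element of `Γ` leads into `Γ`. So the `t^(F - n i)` give a `K`-basis of `(R : 𝔪)/R`,
  -- and `θ` reads off coordinates.
  let θ : maxColon (1 : Submodule R Q) →ₗ[R] (Fin r → K) :=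
    { toFun := fun z i ↦ S.cf z (S.F - n i)
      map_add' := fun a b ↦ by
        ext i
        simp
      map_smul' := fun c a ↦ by
        ext i
        refine S.cf_mul_of_forall fun h hh h0 ↦ ?_
        by_contra hne
        have h1 := hcolon a a.2 _ h hne hh h0
        exact (hgen i).1 _ h1 (by ring) }
  have hθ : Function.Surjective θ := by
    intro c
    have hmem : ∑ i, S.mon (S.F - n i) (c i) ∈ maxColon (1 : Submodule R Q) := by
      refine Submodule.sum_mem _ fun i _ s hs ↦ (S.mem_one_iff _).mpr fun m hm ↦ ?_
      change S.cf _ m ≠ 0 at hm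
      rw [Algebra.smul_def, mul_comm, S.cf_mon_mul] at hm
      have h1 := right_ne_zero_of_mul hm
      have h0 : m - (S.F - n i) ≠ 0 := by
        intro h0
        rw [h0] at h1
        exact h1 (S.mem_maximalIdeal_iff.mp hs)
      have h2 := (hgen i).2 _ (S.algebraMap_mem s h1) h0
      simp only [SemigroupCoordinates.canonicalSet, Set.mem_ofPred_eq] at h2
      push Not at h2
      obtain ⟨h, hh, heq⟩ := h2
      have : m = h := by omega
      rwa [this]
    refine ⟨⟨_, hmem⟩, ?_⟩
    ext j
    change S.cf _ _ = _
    rw [S.cf_sum, Finset.sum_eq_single j]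
    · rw [S.cf_mon, if_pos rfl]
    · intro i _ hij
      rw [S.cf_mon, if_neg]
      intro h
      exact hij (hn (by omega))
    · simp
  have hθ0 : ∀ z, θ z = 0 ↔ (z : Q) ∈ (1 : Submodule R Q) := by
    intro z
    rw [S.mem_one_iff]
    constructor
    · intro hz m hm
      by_contra hmΓ
      have hg : S.F - m ∉ S.generatorSet := by
        rw [← hrange]
        rintro ⟨i, hi⟩
        have := congrFun hz i
        change S.cf z (S.F - n i) = 0 at this
        rw [hi, sub_sub_cancel] at this
        exact hm this
      have h1 : S.F - m ∈ S.canonicalSet := by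
        intro h hh heq
        have : m = h := by omega
        exact hmΓ (this ▸ hh)
      refine hg ⟨h1, fun h hh h0 hmem ↦ ?_⟩
      exact hmem _ (hcolon z z.2 m h hm hh h0) (by ring)
    · intro hz
      ext i
      by_contra hne
      exact (hgen i).1 _ (hz _ hne) (by ring)
  let e₁ : (1 : Submodule R Q) ≃ₗ[R] LinearMap.range (Algebra.linearMap R Q) :=
    LinearEquiv.ofEq _ _ Submodule.one_eq_range
  let e₂ : R ≃ₗ[R] LinearMap.range (Algebra.linearMap R Q) :=
    LinearEquiv.ofInjective (Algebra.linearMap R Q) (IsFractionRing.injective R Q)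
  rw [cmType, length_ext_one hR (e₁.trans e₂.symm) θ hθ hθ0, Module.length_pi_of_fintype]
  simp [hK]

end CMType

/-! ### Laurent series as the fraction field -/

section Coordinates

variable {R : Type u} [CommRing R] [IsDomain R] {K : Type v} [Field K] {H : AddSubmonoid ℕ}

lemma exists_frobenius (hH : (H : Set ℕ)ᶜ.Finite) :
    ∃ F : ℤ, (∀ h ∈ H, (h : ℤ) ≠ F) ∧ ∀ n : ℤ, F < n → ∃ h ∈ H, (h : ℤ) = n := by
  rcases (H : Set ℕ)ᶜ.eq_empty_or_nonempty with he | hne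
  -- Without gaps the Frobenius number is `-1`.
  · refine ⟨-1, fun h _ ↦ by omega, fun n hn ↦ ⟨n.toNat, ?_, by omega⟩⟩
    by_contra hmem
    have : n.toNat ∈ (H : Set ℕ)ᶜ := hmem
    rw [he] at this
    exact this
  · obtain ⟨F, hF, hmax⟩ := Set.exists_max_image _ id hH hne
    refine ⟨F, fun h hh heq ↦ hF (Nat.cast_injective heq ▸ hh), fun n hn ↦
      ⟨n.toNat, ?_, by omega⟩⟩
    by_contra hmem
    have := hmax n.toNat hmem
    simp only [id] at this
    omega

lemma nonempty_semigroupCoordinates (hH : (H : Set ℕ)ᶜ.Finite)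
    (ι : R ≃+* semigroupRing K H) :
    Nonempty (SemigroupCoordinates R (FractionRing R) K) := by
  obtain ⟨F, hF, hFlt⟩ := exists_frobenius hH
  let φ : R →+* LaurentSeries K :=
    (HahnSeries.ofPowerSeries ℤ K).comp ((semigroupRing K H).subtype.comp ι.toRingHom)
  have hφ : Function.Injective φ := HahnSeries.ofPowerSeries_injective.comp
    (Subtype.val_injective.comp ι.injective)
  have hrange : ∀ x : LaurentSeries K, (∃ r, φ r = x) ↔
      ∀ n, x.coeff n ≠ 0 → n ∈ H.map (Nat.castAddMonoidHom ℤ) := by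
    intro x
    constructor
    · rintro ⟨r, rfl⟩ n hn
      change ((((ι r : semigroupRing K H) : PowerSeries K) : LaurentSeries K)).coeff n ≠ 0 at hn
      rw [PowerSeries.coeff_coe] at hn
      split_ifs at hn with h0
      · exact absurd rfl hn
      · exact ⟨n.natAbs, (ι r).2 _ hn, by simpa using not_lt.mp h0⟩
    · intro hx
      let p : PowerSeries K := PowerSeries.mk fun n ↦ x.coeff n
      have hp : p ∈ semigroupRing K H := by
        intro m hm
        rw [PowerSeries.coeff_mk] at hm
        obtain ⟨h, hh, heq⟩ := hx _ hm
        have : h = m := Nat.cast_injective heq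
        exact this ▸ hh
      refine ⟨ι.symm ⟨p, hp⟩, ?_⟩
      have h1 : φ (ι.symm ⟨p, hp⟩) = (p : LaurentSeries K) := by simp [φ]
      rw [h1]
      ext n
      rw [PowerSeries.coeff_coe]
      split_ifs with h0
      · by_contra hne
        obtain ⟨h, -, heq⟩ := hx n (Ne.symm hne)
        have heq' : (h : ℤ) = n := heq
        omega
      · rw [PowerSeries.coeff_mk]
        congr 1
        omega
  let : Algebra R (LaurentSeries K) := φ.toAlgebra
  have : FaithfulSMul R (LaurentSeries K) :=
    (faithfulSMul_iff_algebraMap_injective R (LaurentSeries K)).mpr hφ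
  have hfrac : IsFractionRing R (LaurentSeries K) := by
    refine IsFractionRing.of_field R (LaurentSeries K) fun z ↦ ?_
    -- Large enough that `t^N` and `t^N z` have only exponents above `F`, so both lie in `R`.
    set N : ℤ := max 0 (F + 1) + max 0 (-z.order) with hN
    obtain ⟨s, hs⟩ := (hrange (HahnSeries.single N (1 : K))).mpr (by
      intro n hn
      have hnN : n = N := by
        by_contra hne
        exact hn (HahnSeries.coeff_single_of_ne hne)
      obtain ⟨h, hh, heq⟩ := hFlt n (by omega)
      exact ⟨h, hh, heq⟩)
    obtain ⟨r, hr⟩ := (hrange (HahnSeries.single N (1 : K) * z)).mpr (by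
      intro n hn
      rw [HahnSeries.coeff_single_mul, one_mul] at hn
      have h1 := HahnSeries.order_le_of_coeff_ne_zero hn
      obtain ⟨h, hh, heq⟩ := hFlt n (by omega)
      exact ⟨h, hh, heq⟩)
    refine ⟨r, s, ?_⟩
    change z = φ r / φ s
    rw [hr, hs, mul_div_cancel_left₀]
    exact HahnSeries.single_ne_zero one_ne_zero
  let e : FractionRing R ≃ₐ[R] LaurentSeries K := FractionRing.algEquiv R (LaurentSeries K)
  exact ⟨{
    σ := e.toRingEquiv
    Γ := H.map (Nat.castAddMonoidHom ℤ)
    F := F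
    nonneg := by
      rintro _ ⟨h, -, rfl⟩
      exact Int.natCast_nonneg h
    notMem := by
      rintro ⟨h, hh, heq⟩
      exact hF h hh heq
    mem_of_lt := fun n hn ↦ by
      obtain ⟨h, hh, heq⟩ := hFlt n hn
      exact ⟨h, hh, heq⟩
    mem_one_iff := fun x ↦ by
      rw [Submodule.mem_one]
      refine Iff.trans ?_ (hrange (e x))
      refine exists_congr fun r ↦ ?_
      rw [← e.injective.eq_iff, e.commutes]
      rfl }⟩

end Coordinates

/-! ### The two implications and the first values -/

section Main

lemma isFractional_Rbar {R : Type u} [CommRing R] [Module.Finite R (Rbar R)] :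
    IsFractional (nonZeroDivisors R) (Subalgebra.toSubmodule (Rbar R)) :=
  FractionalIdeal.isFractional_of_fg (Module.Finite.iff_fg.mp ‹_›)

lemma exists_conductor {R : Type u} [CommRing R] [Nontrivial R] [Module.Finite R (Rbar R)] : ∃ d : R, d ≠ 0 ∧
    ∀ v : Rbar R, ∃ r, algebraMap R (Rbar R) r = algebraMap R (Rbar R) d * v := by
  obtain ⟨d, hd, hdv⟩ := isFractional_Rbar (R := R)
  refine ⟨d, nonZeroDivisors.ne_zero hd, fun v ↦ ?_⟩
  obtain ⟨r, hr⟩ := hdv v v.2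
  rw [Algebra.smul_def] at hr
  exact ⟨r, Subtype.ext hr⟩

lemma maximalIdeal_ne_bot {R : Type u} [CommRing R] [IsLocalRing R] (hRf : ¬ IsField R) :
    maximalIdeal R ≠ ⊥ :=
  fun h ↦ hRf (isField_iff_maximalIdeal_eq.mpr h)

variable {R : Type u} [CommRing R] [IsDomain R] [IsNoetherianRing R] [IsLocalRing R]
  [Ring.DimensionLEOne R] [Module.Finite R (Rbar R)] {ω : Type u} [AddCommGroup ω] [Module R ω]

lemma exists_reduction [IsLocalRing (Rbar R)]
    (hRf : ¬ IsField R) (hd : HasPrincipalReduction R)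
    (hres : Function.Bijective (ResidueField.map (algebraMap R (Rbar R)))) :
    ∃ a ∈ maximalIdeal R, ∃ e : ℕ, Ring.ord (Rbar R) (algebraMap R (Rbar R) a) = e ∧
      multiplicity R = e ∧ 0 < e ∧
      ∀ r ∈ maximalIdeal R, algebraMap R (Rbar R) a ∣ algebraMap R (Rbar R) r := by
  have := integralClosure_isDiscreteValuationRing (R := R) (Q := FractionRing R) hRf
  obtain ⟨a, ha, ha0, n, h⟩ := hd
  have ha0' := nonZeroDivisors.ne_zero ha0
  have hinj := FaithfulSMul.algebraMap_injective R (Rbar R)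
  have haV : algebraMap R (Rbar R) a ≠ 0 := by rwa [Ne, map_eq_zero_iff _ hinj]
  refine ⟨a, ha, _, (ENat.natCast_toNat (Ring.ord_ne_top
    (mem_nonZeroDivisors_of_ne_zero haV))).symm,
    multiplicity_eq_ord hinj hres.2 exists_conductor ha ha0' h, ?_,
    fun r hr ↦ algebraMap_dvd_of_reduction haV h ha hr⟩
  rw [pos_iff_ne_zero, Ne, ENat.toNat_eq_zero, not_or]
  refine ⟨?_, Ring.ord_ne_top (mem_nonZeroDivisors_of_ne_zero haV)⟩
  rw [Ring.ord, Module.length_eq_zero_iff, Ideal.Quotient.subsingleton_iff,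
    Ideal.span_singleton_eq_top]
  intro hu
  exact (mem_nonunits_iff.mp ((mem_maximalIdeal a).mp ha))
    ((isUnit_map_iff (algebraMap R (Rbar R)) a).mp hu)

lemma isFarFlungGorenstein_iff (hRf : ¬ IsField R) (hω : IsCanonicalModule R ω)
    {C : Submodule R (FractionRing R)} (hC : IsFractionalCanonicalModule R ω C) :
    IsFarFlungGorenstein R ω ↔ C * C = Subalgebra.toSubmodule (Rbar R) := by
  obtain ⟨e⟩ := hC.iso
  have hdual := hω.isDualizing (maximalIdeal_ne_bot hRf) e
  rw [IsFarFlungGorenstein, map_traceIdeal e hC.one_le]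
  exact hdual.one_div_mul_eq_iff hC.one_le hC.le_Rbar isFractional_Rbar

lemma IsRohrbachSystem.isFarFlungGorenstein [IsLocalRing (Rbar R)]
    (hRf : ¬ IsField R) (hω : IsCanonicalModule R ω)
    (hd : HasPrincipalReduction R)
    (hres : Function.Bijective (ResidueField.map (algebraMap R (Rbar R))))
    {C : Submodule R (FractionRing R)} {r : ℕ} {f : Fin r → Rbar R} {n : Fin r → ℕ}
    (h : IsRohrbachSystem R ω C r f n) : IsFarFlungGorenstein R ω := by
  have := integralClosure_isDiscreteValuationRing (R := R) (Q := FractionRing R) hRf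
  rw [isFarFlungGorenstein_iff hRf hω h.canonical]
  obtain ⟨a, ha, e, hae, hmult, -, -⟩ := exists_reduction hRf hd hres
  have hf : ∀ i, (f i : FractionRing R) ∈ C := fun i ↦ by
    rw [h.span_eq]
    exact Submodule.subset_span ⟨i, rfl⟩
  have hord : ∀ i, Ring.ord (Rbar R) (f i) = n i := h.val_eq
  have htop := eq_top_of_forall_ord hres.2 ha hae
    ((C * C).comap (Rbar R).val.toLinearMap) (by
      intro k hk
      obtain ⟨i, j, -, hij⟩ := h.sums k (by rw [hmult]; exact_mod_cast hk)
      refine ⟨f i * f j, Submodule.mul_mem_mul (hf i) (hf j), ?_⟩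
      rw [Ring.ord_mul _ (mem_nonZeroDivisors_of_ne_zero (ne_zero_of_ord_eq (hord j))), hord,
        hord, ← hij, Nat.cast_add])
  refine le_antisymm ?_ fun x hx ↦ ?_
  · calc C * C ≤ _ := mul_le_mul' h.canonical.le_Rbar h.canonical.le_Rbar
      _ = _ := Subalgebra.isIdempotentElem_toSubmodule _
  · have h1 : (⟨x, hx⟩ : Rbar R) ∈ (C * C).comap (Rbar R).val.toLinearMap := htop ▸ trivial
    exact h1

lemma IsRohrbachSystem.first_values [IsLocalRing (Rbar R)]
    (hRf : ¬ IsField R)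
    (hd : HasPrincipalReduction R)
    (hres : Function.Bijective (ResidueField.map (algebraMap R (Rbar R))))
    {C : Submodule R (FractionRing R)} {r : ℕ} {f : Fin r → Rbar R} {n : Fin r → ℕ}
    (h : IsRohrbachSystem R ω C r f n) :
    (∃ h : 0 < r, n ⟨0, h⟩ = 0) ∧ (1 < multiplicity R → ∃ h : 1 < r, n ⟨1, h⟩ = 1) := by
  obtain ⟨a, ha, e, hae, hmult, he, -⟩ := exists_reduction hRf hd hres
  obtain ⟨i, j, -, hij⟩ := h.sums 0 (by rw [hmult]; exact_mod_cast he)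
  have hr : 0 < r := i.pos
  have h0 : n ⟨0, hr⟩ = 0 := by
    have h1 : n ⟨0, hr⟩ ≤ n i := h.strictMono.monotone (Fin.mk_le_of_le_val (Nat.zero_le _))
    omega
  refine ⟨⟨hr, h0⟩, fun hm ↦ ?_⟩
  obtain ⟨i, j, -, hij⟩ := h.sums 1 (by exact_mod_cast hm)
  obtain ⟨p, hp⟩ : ∃ p, n p = 1 := by
    by_cases hi : n i = 1
    · exact ⟨i, hi⟩
    · exact ⟨j, by omega⟩
  have hp0 : 1 ≤ p.val := by
    by_contra hlt
    have : p = ⟨0, hr⟩ := Fin.ext (by simp; omega)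
    rw [this, h0] at hp
    omega
  have hr1 : 1 < r := by have := p.2; omega
  refine ⟨hr1, ?_⟩
  have h1 : n ⟨1, hr1⟩ ≤ n p := h.strictMono.monotone (Fin.mk_le_of_le_val hp0)
  have h2 : n ⟨0, hr⟩ < n ⟨1, hr1⟩ := h.strictMono (by simp)
  omega

/-- The colon of the given `C` by the standard module is contained in `C`, since `1` is in the
standard module, and contains a nonzero element of the conductor; so the cyclicity criterion
applies. -/
lemma SemigroupCoordinates.isFractionalCanonicalModule {K : Type*} [Field K]
    (S : SemigroupCoordinates R (FractionRing R) K) (hRf : ¬ IsField R)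
    (hω : IsCanonicalModule R ω) (ha : ∃ C, IsFractionalCanonicalModule R ω C) :
    IsFractionalCanonicalModule R ω S.canonical := by
  obtain ⟨C, hC⟩ := ha
  obtain ⟨e⟩ := hC.iso
  have hdual := hω.isDualizing (maximalIdeal_ne_bot hRf) e
  have hinj := IsFractionRing.injective R (FractionRing R)
  have hVfg : (Subalgebra.toSubmodule (Rbar R)).FG := Module.Finite.iff_fg.mp ‹_›
  have hJC : C / S.canonical ≤ C := fun z hz ↦ by
    simpa using Submodule.mem_div_iff_forall_mul_mem.mp hz 1
      (Submodule.one_le.mp S.one_le_canonical)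
  have hJV := hJC.trans hC.le_Rbar
  have hJ0 : C / S.canonical ≠ ⊥ := by
    obtain ⟨d, hd0, hd⟩ := exists_conductor (R := R)
    intro h
    have h1 : algebraMap R (FractionRing R) d ∈ C / S.canonical := by
      rw [Submodule.mem_div_iff_forall_mul_mem]
      intro y hy
      obtain ⟨r, hr⟩ := hd ⟨y, S.canonical_le hy⟩
      have hr' : algebraMap R (FractionRing R) r = algebraMap R (FractionRing R) d * y :=
        congrArg Subtype.val hr
      rw [← hr']
      exact hC.one_le (Submodule.algebraMap_mem r)
    rw [h, Submodule.mem_bot, map_eq_zero_iff _ hinj] at h1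
    exact hd0 h1
  obtain ⟨e'⟩ := hdual.nonempty_linearEquiv (maximalIdeal_ne_bot hRf) hinj
    (isFractional_mono S.canonical_le isFractional_Rbar)
    (fun h ↦ one_ne_bot (le_bot_iff.mp (h ▸ S.one_le_canonical)))
    (Submodule.FG.of_le hVfg hJV) (isFractional_mono hJV isFractional_Rbar) hJ0
    S.eq_maxColon_canonical
  exact ⟨S.one_le_canonical, S.canonical_le, ⟨e'.trans e⟩⟩

lemma SemigroupCoordinates.exists_isRohrbachSystem {K : Type*} [Field K]
    [IsLocalRing (Rbar R)]
    (S : SemigroupCoordinates R (FractionRing R) K) (hRf : ¬ IsField R)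
    (hω : IsCanonicalModule R ω) (ha : ∃ C, IsFractionalCanonicalModule R ω C)
    (hd : HasPrincipalReduction R)
    (hres : Function.Bijective (ResidueField.map (algebraMap R (Rbar R))))
    (hff : IsFarFlungGorenstein R ω) : ∃ C r f n, IsRohrbachSystem R ω C r f n := by
  have := integralClosure_isDiscreteValuationRing (R := R) (Q := FractionRing R) hRf
  have hcan := S.isFractionalCanonicalModule hRf hω ha
  have hsq := (isFarFlungGorenstein_iff hRf hω hcan).mp hff
  obtain ⟨a, ham, e, hae, hmult, -, hdvd⟩ := exists_reduction hRf hd hres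
  have hfin : {k : ℕ | (k : ℤ) ∈ S.generatorSet}.Finite :=
    S.generatorSet_finite.preimage Nat.cast_injective.injOn
  set T := hfin.toFinset with hT
  let n : Fin T.card → ℕ := T.orderEmbOfFin rfl
  have hnrange : ∀ k : ℕ, (k : ℤ) ∈ S.generatorSet ↔ ∃ i, n i = k := by
    intro k
    have h1 : k ∈ T ↔ k ∈ Set.range (T.orderEmbOfFin rfl) := by
      rw [Finset.range_orderEmbOfFin]
      rfl
    rw [hT, Set.Finite.mem_toFinset] at h1
    exact h1
  have hrange : Set.range (fun i ↦ (n i : ℤ)) = S.generatorSet := by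
    ext m
    constructor
    · rintro ⟨i, rfl⟩
      exact (hnrange _).mpr ⟨i, rfl⟩
    · intro hm
      have h0 := S.nonneg_of_mem_canonicalSet hm.1
      lift m to ℕ using h0
      obtain ⟨i, hi⟩ := (hnrange m).mp hm
      exact ⟨i, congrArg Nat.cast hi⟩
  have hnmono : StrictMono n := (T.orderEmbOfFin rfl).strictMono
  refine ⟨S.canonical, T.card,
    fun i ↦ ⟨S.mon (n i) 1, S.mon_mem_integralClosure (Int.natCast_nonneg _) 1⟩, n, ?_⟩
  refine ⟨hcan, ?_, ?_, fun i ↦ S.ord_mon (n i), hnmono, fun k hk ↦ ?_⟩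
  · rw [S.canonical_eq_span, ← hrange, ← Set.range_comp]
    rfl
  · exact (S.cmType_eq (maximalIdeal_ne_bot hRf) (fun i ↦ (n i : ℤ))
      (Nat.cast_injective.comp hnmono.injective) hrange).symm
  · rw [hmult, Nat.cast_lt] at hk
    obtain ⟨g, hg, g', hg', h, hh, heq⟩ := S.exists_of_mon_mem_canonical_mul (n := k) (by
      rw [hsq]
      exact S.mon_mem_integralClosure (Int.natCast_nonneg k) 1)
    have hg0 := S.nonneg_of_mem_canonicalSet hg.1
    have hg0' := S.nonneg_of_mem_canonicalSet hg'.1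
    have hh0 := S.nonneg h hh
    -- In `R̄` the reduction divides all of `𝔪`, so a nonzero `h ∈ Γ` satisfies `h = v(t^h) ≥ e >
    -- k`, whereas `h ≤ k`.
    have hzero : h = 0 := by
      by_contra hne
      obtain ⟨s, hs, hst⟩ := S.exists_maximalIdeal_mon hh hne
      lift h to ℕ using hh0
      have h1 := Ring.ord_le_ord_of_dvd (hdvd s hs)
      have h2 : algebraMap R (Rbar R) s =
          ⟨S.mon h 1, S.mon_mem_integralClosure (Int.natCast_nonneg h) 1⟩ := Subtype.ext hst
      rw [hae, h2, S.ord_mon, Nat.cast_le] at h1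
      omega
    subst hzero
    lift g to ℕ using hg0
    lift g' to ℕ using hg0'
    obtain ⟨i, hi⟩ := (hnrange g).mp hg
    obtain ⟨j, hj⟩ := (hnrange g').mp hg'
    rcases le_total i j with hij | hij
    · exact ⟨i, j, hij, by omega⟩
    · exact ⟨j, i, hij, by omega⟩

end Main

end

end FarFlung


theorem mainTheorem5 {R : Type u} [CommRing R] [IsNoetherianRing R] [IsLocalRing R]
    -- `R` is Cohen-Macaulay of dimension one, with canonical module `ω`
    (hdim : ringKrullDim R = 1)
    (hCM : ∃ x ∈ maximalIdeal R, x ∈ nonZeroDivisors R)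
    (ω : Type u) [AddCommGroup ω] [Module R ω] (hω : FarFlung.IsCanonicalModule R ω)
    -- conditions (a), (b), (c), (d)
    (ha : ∃ C, FarFlung.IsFractionalCanonicalModule R ω C)
    (hb : Module.Finite R (FarFlung.Rbar R))
    [hc : IsLocalRing (FarFlung.Rbar R)]
    (hd : FarFlung.HasPrincipalReduction R)
    -- the residue fields of `R` and `R̄` agree
    (hres : Function.Bijective (ResidueField.map (algebraMap R (FarFlung.Rbar R)))) :
    -- (ii) implies (i)
    ((∃ C r f n, FarFlung.IsRohrbachSystem R ω C r f n) → FarFlung.IsFarFlungGorenstein R ω) ∧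
    -- (i) implies (ii) for numerical semigroup rings
    (∀ (K : Type v) [Field K] (H : AddSubmonoid ℕ), (H : Set ℕ)ᶜ.Finite →
      Nonempty (R ≃+* FarFlung.semigroupRing K H) →
      FarFlung.IsFarFlungGorenstein R ω → ∃ C r f n, FarFlung.IsRohrbachSystem R ω C r f n) ∧
    -- in case (ii), `n_1 = 0`, and, if `e(R) > 1`, then `n_2` exists and `n_2 = 1`
    (∀ C r f n, FarFlung.IsRohrbachSystem R ω C r f n →
      (∃ h : 0 < r, n ⟨0, h⟩ = 0) ∧
      (1 < FarFlung.multiplicity R → ∃ h : 1 < r, n ⟨1, h⟩ = 1)) := by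
  have hK1 : Ring.KrullDimLE 1 R := Ring.krullDimLE_iff.mpr (by simp [hdim])
  -- The duality and valuation arguments concern domains; `R` is one because it embeds in the field
  -- `Q(R)`.
  have hfield := FarFlung.isField_fractionRing R hCM
  have : IsDomain (FractionRing R) := hfield.isDomain
  have : IsDomain R := (IsFractionRing.injective R (FractionRing R)).isDomain
  have : Ring.DimensionLEOne R :=
    ⟨fun {p} hp hp' ↦ Ring.krullDimLE_one_iff_of_noZeroDivisors.mp hK1 p hp hp'⟩
  have hRf : ¬ IsField R := by
    intro h
    obtain ⟨x, hx, hx'⟩ := hCM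
    rw [isField_iff_maximalIdeal_eq.mp h, Ideal.mem_bot] at hx
    exact nonZeroDivisors.ne_zero hx' hx
  refine ⟨?_, ?_, ?_⟩
  · rintro ⟨C, r, f, n, h⟩
    exact h.isFarFlungGorenstein hRf hω hd hres
  · rintro K _ H hH ⟨ι⟩ hff
    obtain ⟨S⟩ := FarFlung.nonempty_semigroupCoordinates hH ι
    exact S.exists_isRohrbachSystem hRf hω ha hd hres hff
  · intro C r f n h
    exact h.first_values hRf hd hres
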